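/- Let $G$ be a countable group, let $G$ act measurably on a probability space $(Y,\nu)$ preserving $\nu$, and let $(K,\kappa)$ be a non-trivial probability space (some measurable $A\subseteq K$ has $0<\kappa(A)<1$). Let $\mathrm{Sub}(G)$ be the space of subgroups of $G$, with the Borel $\sigma$-algebra of the topology whose basic open sets are $\{H : H\cap T=F\}$ ($F\subseteq T\subseteq G$ finite), and let $G$ act on it by conjugation $g\cdot\Gamma=g\Gamma g^{-1}$. Let $G$ act on $K^G$ by $(g\cdot x)(t)=x(g^{-1}t)$. For $\Gamma\in\mathrm{Sub}(G)$ let $\kappa^{\Gamma\backslash G}$ be the product measure on $K^{\Gamma\backslash G}$, viewed as a measure on $K^G$ by identifying $K^{\Gamma\backslash G}$ with the set of $x\in K^G$ that are constant on the right cosets $\Gamma t$. Let $A=L^\infty_\nu(Y)\rtimes_{\mathrm{alg}}G$ be the $*$-algebra of finite formal sums $\sum_g s_gu_g$ with $s_g\in L^\infty_\nu(Y)$, relations $u_gs=(s\circ g^{-1})u_g$, $u_gu_h=u_{gh}$ and involution $(\sum_g s_gu_g)^*=\sum_g(\bar s_g\circ g)u_{g^{-1}}$. For a $G$-equivariant factor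 map $\phi:(X,\mu)\to(Y,\nu)$ of probability-measure-preserving actions, the generalized Koopman representation $\rho$ of $A$ on $L^2_\mu(X)$ is given by $(\rho(su_g)f)(x)=s(\phi(x))f(g^{-1}\cdot x)$; it leaves invariant the orthogonal complement $L^2_\mu(X)\ominus L^2_\nu(Y)$ of $L^2_\nu(Y)\cong\{f\circ\phi : f\in L^2_\nu(Y)\}$. A $*$-representation of $A$ embeds into another if there is a linear isometry between their Hilbert spaces that intertwines them; $\lambda^{\oplus\mathbb N}$ is the direct sum of countably infinitely many copies of $\lambda$. 1. Let $y\mapsto\Gamma_y\in\mathrm{Sub}(G)$ be a $G$-equivariant measurable map on $Y$ such that every $\Gamma_y$ has infinite index in $G$. Let $\lambda$ be the $*$-representation of $A$ on $\int_Y^\oplus\ell^2(\Gamma_y\backslash G)\,d\nu(y)$ given by $(\lambda(su_g)f)(y)(\Gamma_yh)=s(y)\,f(g^{-1}\cdot y)(g^{-1}\Gamma_yh)$, and let $$(X,\mu)=\Big(K^G\times Y,\ \int_Y\kappa^{\Gamma_y\backslash G}\times\delta_y\,d\nu(y)\Big),$$ with the diagonal action of $G$ and the projection $\phi:X\to Y$.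 Then $\lambda^{\oplus\mathbb N}$ embeds into $\rho|_{L^2_\mu(X)\ominus L^2_\nu(Y)}$. 2. Let $\omega$ be a $G$-invariant probability measure on $\mathrm{Sub}(G)\times Y$ (diagonal action, product $\sigma$-algebra) whose projection to $Y$ is $\nu$ and such that $\Gamma$ has infinite index in $G$ for $\omega$-almost every $(\Gamma,y)$. Let $\lambda$ be the $*$-representation of $A$ on $\int_{\mathrm{Sub}(G)\times Y}^\oplus\ell^2(\Gamma\backslash G)\,d\omega(\Gamma,y)$ given by $(\lambda(su_g)f)(\Gamma,y)(\Gamma h)=s(y)\,f(g^{-1}\Gamma g,\,g^{-1}\cdot y)(g^{-1}\Gamma h)$, and let $$(X,\mu)=\Big(K^G\times Y,\ \int_{\mathrm{Sub}(G)\times Y}\kappa^{\Gamma\backslash G}\times\delta_y\,d\omega(\Gamma,y)\Big),$$ with the diagonal action of $G$ and the projection $\phi:X\to Y$. Then $\lambda^{\oplus\mathbb N}$ embeds into $\rho|_{L^2_\mu(X)\ominus L^2_\nu(Y)}$. -/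

import Mathlib

open MeasureTheory
open scoped ENNReal

noncomputable section

namespace NonfreeBernoulli

section Linfty

variable {Y : Type*} [MeasurableSpace Y]

/-- `L^∞_ν(Y)`: essentially bounded complex functions modulo `ν`-almost everywhere equality.
Addition, scalar multiplication and complex conjugation are those of Mathlib; the pointwise
product is added below. -/
abbrev Linfty (ν : Measure Y) : Type _ := Lp ℂ ∞ ν

variable {ν : Measure Y}

instance : Mul (Linfty ν) where
  mul s t := ((Lp.memLp t).mul (Lp.memLp s)).toLp (fun y => s y * t y)

theorem Linfty.coeFn_mul (s t : Linfty ν) : ⇑(s * t) =ᵐ[ν] fun y => s y * t y :=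
  MemLp.coeFn_toLp _

instance : One (Linfty ν) where
  one := (memLp_top_const (1 : ℂ)).toLp (fun _ => (1 : ℂ))

theorem Linfty.coeFn_one : ⇑(1 : Linfty ν) =ᵐ[ν] fun _ => (1 : ℂ) :=
  MemLp.coeFn_toLp _

instance : CommRing (Linfty ν) where
  __ := (inferInstance : AddCommGroup (Lp ℂ ∞ ν))
  mul_assoc a b c := by
    apply Lp.ext
    filter_upwards [Linfty.coeFn_mul (a * b) c, Linfty.coeFn_mul a b, Linfty.coeFn_mul a (b * c),
      Linfty.coeFn_mul b c] with y h1 h2 h3 h4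
    rw [h1, h2, h3, h4, mul_assoc]
  one_mul a := by
    apply Lp.ext
    filter_upwards [Linfty.coeFn_mul 1 a, Linfty.coeFn_one (ν := ν)] with y h1 h2
    rw [h1, h2, one_mul]
  mul_one a := by
    apply Lp.ext
    filter_upwards [Linfty.coeFn_mul a 1, Linfty.coeFn_one (ν := ν)] with y h1 h2
    rw [h1, h2, mul_one]
  mul_comm a b := by
    apply Lp.ext
    filter_upwards [Linfty.coeFn_mul a b, Linfty.coeFn_mul b a] with y h1 h2
    rw [h1, h2, mul_comm]
  left_distrib a b c := by
    apply Lp.ext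
    filter_upwards [Linfty.coeFn_mul a (b + c), Lp.coeFn_add b c, Linfty.coeFn_mul a b,
      Linfty.coeFn_mul a c, Lp.coeFn_add (a * b) (a * c)] with y h1 h2 h3 h4 h5
    rw [h1, h2, h5, Pi.add_apply, Pi.add_apply, h3, h4, mul_add]
  right_distrib a b c := by
    apply Lp.ext
    filter_upwards [Linfty.coeFn_mul (a + b) c, Lp.coeFn_add a b, Linfty.coeFn_mul a c,
      Linfty.coeFn_mul b c, Lp.coeFn_add (a * c) (b * c)] with y h1 h2 h3 h4 h5
    rw [h1, h2, h5, Pi.add_apply, Pi.add_apply, h3, h4, add_mul]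
  zero_mul a := by
    apply Lp.ext
    filter_upwards [Linfty.coeFn_mul 0 a, Lp.coeFn_zero ℂ ∞ ν] with y h1 h2
    rw [h1, h2, Pi.zero_apply, zero_mul]
  mul_zero a := by
    apply Lp.ext
    filter_upwards [Linfty.coeFn_mul a 0, Lp.coeFn_zero ℂ ∞ ν] with y h1 h2
    rw [h1, h2, Pi.zero_apply, mul_zero]

theorem Linfty.smul_mul (r : ℂ) (a b : Linfty ν) : r • a * b = r • (a * b) := by
  apply Lp.ext
  filter_upwards [Linfty.coeFn_mul (r • a) b, Lp.coeFn_smul r a, Lp.coeFn_smul r (a * b),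
    Linfty.coeFn_mul a b] with y h1 h2 h3 h4
  rw [h1, h2, h3, Pi.smul_apply, Pi.smul_apply, h4, smul_mul_assoc]

instance : Algebra ℂ (Linfty ν) :=
  Algebra.ofModule Linfty.smul_mul
    (fun r a b => by rw [mul_comm, Linfty.smul_mul, mul_comm])

instance : StarRing (Linfty ν) where
  star_mul a b := by
    apply Lp.ext
    filter_upwards [Lp.coeFn_star (a * b), Linfty.coeFn_mul a b, Lp.coeFn_star a, Lp.coeFn_star b,
      Linfty.coeFn_mul (star b) (star a)] with y h1 h2 h3 h4 h5
    rw [h1, h5, h3, h4, Pi.star_apply, Pi.star_apply, Pi.star_apply, h2, star_mul]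
  star_add a b := by
    apply Lp.ext
    filter_upwards [Lp.coeFn_star (a + b), Lp.coeFn_add a b, Lp.coeFn_star a, Lp.coeFn_star b,
      Lp.coeFn_add (star a) (star b)] with y h1 h2 h3 h4 h5
    rw [h1, h5, Pi.add_apply, h3, h4, Pi.star_apply, Pi.star_apply, Pi.star_apply, h2,
      Pi.add_apply, star_add]

instance : StarModule ℂ (Linfty ν) where
  star_smul r a := by
    apply Lp.ext
    filter_upwards [Lp.coeFn_star (r • a), Lp.coeFn_smul r a, Lp.coeFn_star a,
      Lp.coeFn_smul (star r) (star a)] with y h1 h2 h3 h4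
    rw [h1, h4, Pi.smul_apply, h3, Pi.star_apply, Pi.star_apply, h2, Pi.smul_apply, star_smul]

variable {G : Type*} [Group G] [MulAction G Y] [MeasurableConstSMul G Y] [SMulInvariantMeasure G Y ν]

/-- The action of `G` on `L^∞_ν(Y)` by `(g • s) y = s (g⁻¹ • y)`. -/
instance : SMul G (Linfty ν) where
  smul g s := Lp.compMeasurePreserving (fun y : Y => g⁻¹ • y) (measurePreserving_smul g⁻¹ ν) s

theorem Linfty.coeFn_smul (g : G) (s : Linfty ν) : ⇑(g • s) =ᵐ[ν] fun y => s (g⁻¹ • y) :=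
  Lp.coeFn_compMeasurePreserving _ _

theorem Linfty.ae_smul (g : G) {p : Y → Prop} (h : ∀ᵐ y ∂ν, p y) : ∀ᵐ y ∂ν, p (g⁻¹ • y) :=
  (measurePreserving_smul g⁻¹ ν).quasiMeasurePreserving.ae h

instance : MulSemiringAction G (Linfty ν) where
  one_smul s := by
    apply Lp.ext
    filter_upwards [Linfty.coeFn_smul (1 : G) s] with y h
    rw [h, inv_one, one_smul]
  mul_smul g h s := by
    apply Lp.ext
    filter_upwards [Linfty.coeFn_smul (g * h) s, Linfty.coeFn_smul g (h • s),
      Linfty.ae_smul g (Linfty.coeFn_smul h s)] with y h1 h2 h3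
    rw [h1, h2, h3, mul_inv_rev, mul_smul]
  smul_zero g := map_zero (Lp.compMeasurePreserving _ (measurePreserving_smul g⁻¹ ν))
  smul_add g s t := map_add (Lp.compMeasurePreserving _ (measurePreserving_smul g⁻¹ ν)) s t
  smul_one g := by
    apply Lp.ext
    filter_upwards [Linfty.coeFn_smul g (1 : Linfty ν), Linfty.coeFn_one (ν := ν),
      Linfty.ae_smul g (Linfty.coeFn_one (ν := ν))] with y h1 h2 h3
    rw [h1, h2, h3]
  smul_mul g s t := by
    apply Lp.ext
    filter_upwards [Linfty.coeFn_smul g (s * t), Linfty.coeFn_mul (g • s) (g • t),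
      Linfty.coeFn_smul g s, Linfty.coeFn_smul g t,
      Linfty.ae_smul g (Linfty.coeFn_mul s t)] with y h1 h2 h3 h4 h5
    rw [h1, h2, h3, h4, h5]

instance : SMulCommClass G ℂ (Linfty ν) where
  smul_comm g r s := by
    apply Lp.ext
    filter_upwards [Linfty.coeFn_smul g (r • s), Lp.coeFn_smul r (g • s), Linfty.coeFn_smul g s,
      Linfty.ae_smul g (Lp.coeFn_smul r s)] with y h1 h2 h3 h4
    rw [h1, h2, h4, Pi.smul_apply, Pi.smul_apply, h3]

theorem Linfty.smul_star (g : G) (s : Linfty ν) : g • star s = star (g • s) := by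
  apply Lp.ext
  filter_upwards [Linfty.coeFn_smul g (star s), Lp.coeFn_star (g • s), Linfty.coeFn_smul g s,
    Linfty.ae_smul g (Lp.coeFn_star s)] with y h1 h2 h3 h4
  rw [h1, h2, h4, Pi.star_apply, Pi.star_apply, h3]

end Linfty

section CrossedProduct

variable (G : Type*) [Group G] {Y : Type*} [MeasurableSpace Y] [MulAction G Y]
  [MeasurableConstSMul G Y] (ν : Measure Y) [SMulInvariantMeasure G Y ν]

/-- The algebraic crossed product of `L^∞_ν(Y)` by `G`: finite formal sums `∑ s_g u_g`, with
`u_g s = (s ∘ g⁻¹) u_g`.  The element `s u_g` is `SkewMonoidAlgebra.single g s`, and the product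
is `(s u_g) (t u_h) = s (g • t) u_{gh}`. -/
abbrev CrossedProduct : Type _ := SkewMonoidAlgebra (Linfty ν) G

variable {G ν}

/-- The involution `(∑ s_g u_g)^* = ∑ (conj s_g ∘ g) u_{g⁻¹}`. -/
instance : Star (CrossedProduct G ν) where
  star a := a.sum fun g s => SkewMonoidAlgebra.single g⁻¹ (g⁻¹ • star s)

theorem CrossedProduct.star_single (g : G) (s : Linfty ν) :
    star (SkewMonoidAlgebra.single g s : CrossedProduct G ν) =
      SkewMonoidAlgebra.single g⁻¹ (g⁻¹ • star s) := by
  change SkewMonoidAlgebra.sum _ _ = _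
  rw [SkewMonoidAlgebra.sum_single_index]
  simp

theorem CrossedProduct.star_add' (a b : CrossedProduct G ν) : star (a + b) = star a + star b := by
  change SkewMonoidAlgebra.sum _ _ = SkewMonoidAlgebra.sum _ _ + SkewMonoidAlgebra.sum _ _
  rw [SkewMonoidAlgebra.sum_add_index']
  · intro g; simp
  · intro g s t; rw [StarAddMonoid.star_add, smul_add, SkewMonoidAlgebra.single_add]

theorem CrossedProduct.star_zero' : star (0 : CrossedProduct G ν) = 0 := by
  change SkewMonoidAlgebra.sum _ _ = _
  exact SkewMonoidAlgebra.sum_zero_index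

instance : StarRing (CrossedProduct G ν) where
  star_involutive a := by
    induction a using SkewMonoidAlgebra.induction_on with
    | zero => rw [CrossedProduct.star_zero', CrossedProduct.star_zero']
    | single g s =>
      rw [CrossedProduct.star_single, CrossedProduct.star_single, ← Linfty.smul_star, star_star,
        inv_inv, smul_inv_smul]
    | add a b ha hb => rw [CrossedProduct.star_add', CrossedProduct.star_add', ha, hb]
  star_add := CrossedProduct.star_add'
  star_mul a b := by
    induction a using SkewMonoidAlgebra.induction_on with
    | zero => rw [zero_mul, CrossedProduct.star_zero', mul_zero]
    | add a a' ha ha' =>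
      rw [add_mul, CrossedProduct.star_add', CrossedProduct.star_add', ha, ha', mul_add]
    | single g s =>
      induction b using SkewMonoidAlgebra.induction_on with
      | zero => rw [mul_zero, CrossedProduct.star_zero', zero_mul]
      | add b b' hb hb' =>
        rw [mul_add, CrossedProduct.star_add', CrossedProduct.star_add', hb, hb', add_mul]
      | single h t =>
        rw [SkewMonoidAlgebra.single_mul_single, CrossedProduct.star_single,
          CrossedProduct.star_single, CrossedProduct.star_single,
          SkewMonoidAlgebra.single_mul_single, mul_inv_rev, star_mul, smul_mul', mul_smul,
          mul_smul, Linfty.smul_star g t |>.symm, inv_smul_smul]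

instance : StarModule ℂ (CrossedProduct G ν) where
  star_smul r a := by
    induction a using SkewMonoidAlgebra.induction_on with
    | zero => rw [smul_zero, CrossedProduct.star_zero', smul_zero]
    | single g s =>
      rw [SkewMonoidAlgebra.smul_single, CrossedProduct.star_single, CrossedProduct.star_single,
        SkewMonoidAlgebra.smul_single, star_smul, smul_comm]
    | add a b ha hb =>
      rw [smul_add, CrossedProduct.star_add', CrossedProduct.star_add', ha, hb, smul_add]

end CrossedProduct

section Representations

variable (G : Type*) [Group G] {Y Z : Type*} [MeasurableSpace Y] [MulAction G Y]
  [MeasurableSpace Z] [MulAction G Z]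

/-- `G` acts on `Z` preserving the (not necessarily finite) measure `m`, and `π : Z → Y` is
`G`-equivariant, measurable and pulls `ν`-null sets back to `m`-null sets.  This is what is needed
for `L^∞_ν(Y)` to act on `L²_m(Z)` compatibly with the action of `G`. -/
structure IsEquivariantOver (π : Z → Y) (m : Measure Z) (ν : Measure Y) : Prop where
  smul_preserving : ∀ g : G, MeasurePreserving (fun z : Z => g • z) m m
  quasi : Measure.QuasiMeasurePreserving π m ν
  equivariant : ∀ (g : G) (z : Z), π (g • z) = g • π z

/-- `π : (Z, m) → (Y, ν)` is a `G`-equivariant factor map of measure preserving `G`-actions. -/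
structure IsFactorMap (π : Z → Y) (m : Measure Z) (ν : Measure Y) : Prop where
  smul_preserving : ∀ g : G, MeasurePreserving (fun z : Z => g • z) m m
  map_preserving : MeasurePreserving π m ν
  equivariant : ∀ (g : G) (z : Z), π (g • z) = g • π z

variable {G} {π : Z → Y} {m : Measure Z} {ν : Measure Y}

theorem IsFactorMap.isEquivariantOver (h : IsFactorMap G π m ν) : IsEquivariantOver G π m ν :=
  ⟨h.smul_preserving, h.map_preserving.quasiMeasurePreserving, h.equivariant⟩

theorem Linfty.ae_norm_le (s : Linfty ν) : ∀ᵐ y ∂ν, ‖s y‖ ≤ ‖s‖ := by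
  filter_upwards [enorm_ae_le_eLpNormEssSup s ν] with y hy
  rw [Lp.norm_def, eLpNorm_exponent_top, ← toReal_enorm]
  exact ENNReal.toReal_mono (by simpa using (Lp.eLpNorm_lt_top s).ne) hy

namespace IsEquivariantOver

theorem ae_smul (hπ : IsEquivariantOver G π m ν) (g : G) {p : Z → Prop} (h : ∀ᵐ z ∂m, p z) :
    ∀ᵐ z ∂m, p (g⁻¹ • z) :=
  (hπ.smul_preserving g⁻¹).quasiMeasurePreserving.ae h

/-- `s ∘ π` as an essentially bounded function on `Z`. -/
theorem memLp_comp (hπ : IsEquivariantOver G π m ν) (s : Linfty ν) :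
    MemLp (fun z => s (π z)) ∞ m := by
  refine memLp_top_of_bound ((Lp.aestronglyMeasurable s).comp_quasiMeasurePreserving hπ.quasi) ‖s‖ ?_
  exact hπ.quasi.ae (Linfty.ae_norm_le s)

/-- Multiplication by `s ∘ π` as a linear map of `L²_m(Z)`. -/
def mulLin (hπ : IsEquivariantOver G π m ν) (s : Linfty ν) : Lp ℂ 2 m →ₗ[ℂ] Lp ℂ 2 m where
  toFun f := ((Lp.memLp f).mul (hπ.memLp_comp s)).toLp (fun z => s (π z) * f z)
  map_add' f f' := by
    rw [← MemLp.toLp_add]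
    apply MemLp.toLp_congr
    filter_upwards [Lp.coeFn_add f f'] with z h
    rw [h, Pi.add_apply, Pi.add_apply, mul_add]
  map_smul' r f := by
    rw [← MemLp.toLp_const_smul]
    apply MemLp.toLp_congr
    filter_upwards [Lp.coeFn_smul r f] with z h
    rw [h, Pi.smul_apply, RingHom.id_apply, Pi.smul_apply, smul_eq_mul, smul_eq_mul]
    ring

theorem coeFn_mulLin (hπ : IsEquivariantOver G π m ν) (s : Linfty ν) (f : Lp ℂ 2 m) :
    ⇑(hπ.mulLin s f) =ᵐ[m] fun z => s (π z) * f z :=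
  MemLp.coeFn_toLp ((Lp.memLp f).mul (hπ.memLp_comp s))

/-- Multiplication by `s ∘ π` as a bounded operator of `L²_m(Z)`. -/
def mulOp (hπ : IsEquivariantOver G π m ν) (s : Linfty ν) : Lp ℂ 2 m →L[ℂ] Lp ℂ 2 m :=
  (hπ.mulLin s).mkContinuous ‖s‖ fun f => by
    apply Lp.norm_le_mul_norm_of_ae_le_mul
    filter_upwards [hπ.coeFn_mulLin s f, hπ.quasi.ae (Linfty.ae_norm_le s)] with z h1 h2
    rw [h1, norm_mul]
    gcongr

theorem coeFn_mulOp (hπ : IsEquivariantOver G π m ν) (s : Linfty ν) (f : Lp ℂ 2 m) :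
    ⇑(hπ.mulOp s f) =ᵐ[m] fun z => s (π z) * f z :=
  hπ.coeFn_mulLin s f

/-- Multiplication operators as an algebra homomorphism. -/
def mulHom (hπ : IsEquivariantOver G π m ν) : Linfty ν →ₐ[ℂ] (Lp ℂ 2 m →L[ℂ] Lp ℂ 2 m) :=
  AlgHom.ofLinearMap
    { toFun := hπ.mulOp
      map_add' := fun s t => by
        ext1 f
        apply Lp.ext
        filter_upwards [hπ.coeFn_mulOp (s + t) f, hπ.coeFn_mulOp s f, hπ.coeFn_mulOp t f,
          Lp.coeFn_add (hπ.mulOp s f) (hπ.mulOp t f), hπ.quasi.ae (Lp.coeFn_add s t)]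
          with z h1 h2 h3 h4 h5
        rw [add_apply, h1, h4, Pi.add_apply, h2, h3, h5, Pi.add_apply, add_mul]
      map_smul' := fun r s => by
        ext1 f
        apply Lp.ext
        filter_upwards [hπ.coeFn_mulOp (r • s) f, hπ.coeFn_mulOp s f,
          Lp.coeFn_smul r (hπ.mulOp s f), hπ.quasi.ae (Lp.coeFn_smul r s)]
          with z h1 h2 h3 h4
        rw [RingHom.id_apply, smul_apply, h1, h3, Pi.smul_apply, h2, h4,
          Pi.smul_apply, smul_mul_assoc] }
    (by
      ext1 f
      apply Lp.ext
      filter_upwards [hπ.coeFn_mulOp 1 f, hπ.quasi.ae (Linfty.coeFn_one (ν := ν))] with z h1 h2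
      change hπ.mulOp 1 f z = f z
      rw [h1, h2, one_mul])
    (fun s t => by
      ext1 f
      apply Lp.ext
      filter_upwards [hπ.coeFn_mulOp (s * t) f, hπ.coeFn_mulOp s (hπ.mulOp t f),
        hπ.coeFn_mulOp t f, hπ.quasi.ae (Linfty.coeFn_mul s t)] with z h1 h2 h3 h4
      change hπ.mulOp (s * t) f z = hπ.mulOp s (hπ.mulOp t f) z
      rw [h1, h2, h3, h4, mul_assoc])

/-- The translation operator `(u_g f) z = f (g⁻¹ • z)` on `L²_m(Z)`. -/
def translate (hπ : IsEquivariantOver G π m ν) (g : G) : Lp ℂ 2 m →L[ℂ] Lp ℂ 2 m :=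
  (Lp.compMeasurePreservingₗᵢ ℂ (fun z : Z => g⁻¹ • z)
    (hπ.smul_preserving g⁻¹)).toContinuousLinearMap

theorem coeFn_translate (hπ : IsEquivariantOver G π m ν) (g : G) (f : Lp ℂ 2 m) :
    ⇑(hπ.translate g f) =ᵐ[m] fun z => f (g⁻¹ • z) :=
  Lp.coeFn_compMeasurePreserving _ _

/-- Translation operators as a homomorphism. -/
def translateHom (hπ : IsEquivariantOver G π m ν) : G →* (Lp ℂ 2 m →L[ℂ] Lp ℂ 2 m) where
  toFun := hπ.translate
  map_one' := by
    ext1 f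
    apply Lp.ext
    filter_upwards [hπ.coeFn_translate 1 f] with z h
    rw [h, inv_one, one_smul, one_apply_eq_self]
  map_mul' g h := by
    ext1 f
    apply Lp.ext
    filter_upwards [hπ.coeFn_translate (g * h) f, hπ.coeFn_translate g (hπ.translate h f),
      hπ.ae_smul g (hπ.coeFn_translate h f)] with z h1 h2 h3
    change hπ.translate (g * h) f z = hπ.translate g (hπ.translate h f) z
    rw [h1, h2, h3, mul_inv_rev, mul_smul]

variable [MeasurableConstSMul G Y] [SMulInvariantMeasure G Y ν]

/-- The representation of the crossed product on `L²_m(Z)` as an algebra homomorphism. -/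
def repAlgHom (hπ : IsEquivariantOver G π m ν) :
    CrossedProduct G ν →ₐ[ℂ] (Lp ℂ 2 m →L[ℂ] Lp ℂ 2 m) :=
  SkewMonoidAlgebra.liftNCAlgHom hπ.mulHom hπ.translateHom (fun {s g} => by
    ext1 f
    apply Lp.ext
    filter_upwards [hπ.coeFn_mulOp (g • s) (hπ.translate g f), hπ.coeFn_translate g f,
      hπ.coeFn_translate g (hπ.mulOp s f), hπ.ae_smul g (hπ.coeFn_mulOp s f),
      hπ.quasi.ae (Linfty.coeFn_smul g s)] with z h1 h2 h3 h4 h5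
    change hπ.mulOp (g • s) (hπ.translate g f) z = hπ.translate g (hπ.mulOp s f) z
    rw [h1, h2, h3, h4, h5, hπ.equivariant])

theorem repAlgHom_single (hπ : IsEquivariantOver G π m ν) (g : G) (s : Linfty ν) :
    hπ.repAlgHom (SkewMonoidAlgebra.single g s) = hπ.mulOp s * hπ.translate g :=
  SkewMonoidAlgebra.liftNC_single _ _ _ _

theorem coeFn_repAlgHom_single (hπ : IsEquivariantOver G π m ν) (g : G) (s : Linfty ν)
    (f : Lp ℂ 2 m) :
    ⇑(hπ.repAlgHom (SkewMonoidAlgebra.single g s) f) =ᵐ[m] fun z => s (π z) * f (g⁻¹ • z) := by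
  rw [repAlgHom_single]
  filter_upwards [hπ.coeFn_mulOp s (hπ.translate g f), hπ.coeFn_translate g f] with z h1 h2
  change hπ.mulOp s (hπ.translate g f) z = _
  rw [h1, h2]

theorem repAlgHom_star_single (hπ : IsEquivariantOver G π m ν) (g : G) (s : Linfty ν) :
    hπ.repAlgHom (star (SkewMonoidAlgebra.single g s)) =
      star (hπ.repAlgHom (SkewMonoidAlgebra.single g s)) := by
  rw [CrossedProduct.star_single, ContinuousLinearMap.star_eq_adjoint,
    ContinuousLinearMap.eq_adjoint_iff]
  intro f f'
  rw [L2.inner_def, L2.inner_def]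
  have e : ∀ {p : Z → Prop}, (∀ᵐ z ∂m, p z) → ∀ᵐ z ∂m, p (g • z) := fun h =>
    (hπ.smul_preserving g).quasiMeasurePreserving.ae h
  have e2 : ∀ᵐ z ∂m, (g⁻¹ • star s : Linfty ν) (π z) = star (s (g • π z)) := by
    filter_upwards [hπ.quasi.ae (Linfty.coeFn_smul g⁻¹ (star s)),
      e (hπ.quasi.ae (Lp.coeFn_star s))] with z h1 h2
    rw [h1, inv_inv, ← hπ.equivariant, h2, Pi.star_apply]
  have e3 := (hπ.smul_preserving g).integral_comp' (f := MeasurableEquiv.mk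
    (MulAction.toPerm g) (hπ.smul_preserving g).measurable (hπ.smul_preserving g⁻¹).measurable)
    (fun z => inner ℂ (f z) (hπ.repAlgHom (SkewMonoidAlgebra.single g s) f' z))
  rw [← e3]
  apply integral_congr_ae
  filter_upwards [hπ.coeFn_repAlgHom_single g⁻¹ (g⁻¹ • star s) f, e2,
    e (hπ.coeFn_repAlgHom_single g s f')] with z h1 h2 h3
  change _ = inner ℂ (f (g • z)) (hπ.repAlgHom (SkewMonoidAlgebra.single g s) f' (g • z))
  rw [h1, h3, h2, inv_inv, inv_smul_smul, hπ.equivariant, RCLike.inner_apply, RCLike.inner_apply,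
    map_mul]
  simp only [RCLike.star_def, RCLike.conj_conj]
  ring

/-- The `*`-representation of the crossed product on `L²_m(Z)`, given by
`(s u_g f) z = s (π z) * f (g⁻¹ • z)`. -/
def rep (hπ : IsEquivariantOver G π m ν) :
    CrossedProduct G ν →⋆ₐ[ℂ] (Lp ℂ 2 m →L[ℂ] Lp ℂ 2 m) :=
  { hπ.repAlgHom with
    map_star' := fun a => by
      change hπ.repAlgHom (star a) = star (hπ.repAlgHom a)
      induction a using SkewMonoidAlgebra.induction_on with
      | zero => rw [CrossedProduct.star_zero', map_zero, star_zero]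
      | single g s => exact hπ.repAlgHom_star_single g s
      | add a b ha hb => rw [CrossedProduct.star_add', map_add, map_add, star_add, ha, hb] }

theorem coeFn_rep_single (hπ : IsEquivariantOver G π m ν) (g : G) (s : Linfty ν) (f : Lp ℂ 2 m) :
    ⇑(hπ.rep (SkewMonoidAlgebra.single g s) f) =ᵐ[m] fun z => s (π z) * f (g⁻¹ • z) :=
  hπ.coeFn_repAlgHom_single g s f

end IsEquivariantOver
end Representations

section Operations

variable {A : Type*} [Semiring A] [Algebra ℂ A] [Star A]
  {H : Type*} [NormedAddCommGroup H] [InnerProductSpace ℂ H]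
  {H' : Type*} [NormedAddCommGroup H'] [InnerProductSpace ℂ H']

/-- The Hilbert space direct sum `H^{⊕ℕ}` of countably many copies of `H`. -/
abbrev CountableSum (H : Type*) [NormedAddCommGroup H] : Type _ := lp (fun _ : ℕ => H) 2

theorem diag_norm_le (T : H →L[ℂ] H) (x : CountableSum H) (n : ℕ) :
    ‖T (x n)‖ ≤ ‖(((‖T‖ : ℂ) • x : CountableSum H) : ℕ → H) n‖ := by
  rw [lp.coeFn_smul, Pi.smul_apply, norm_smul, Complex.norm_real, norm_norm]
  exact T.le_opNorm _

theorem diag_mem (T : H →L[ℂ] H) (x : CountableSum H) : Memℓp (fun n : ℕ => T (x n)) 2 :=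
  (lp.memℓp ((‖T‖ : ℂ) • x)).mono' (diag_norm_le T x)

/-- The linear map `(x_n) ↦ (T x_n)` of `H^{⊕ℕ}`. -/
def diagLin (T : H →L[ℂ] H) : CountableSum H →ₗ[ℂ] CountableSum H where
  toFun x := ⟨fun n : ℕ => T (x n), diag_mem T x⟩
  map_add' x y := lp.ext (funext fun n => map_add T (x n) (y n))
  map_smul' r x := lp.ext (funext fun n => map_smul T r (x n))

/-- The operator `T ⊕ T ⊕ ⋯` on `H^{⊕ℕ}`. -/
def diagOp (T : H →L[ℂ] H) : CountableSum H →L[ℂ] CountableSum H :=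
  (diagLin T).mkContinuous ‖T‖ fun x => by
    have h := lp.norm_mono (p := 2) two_ne_zero (x := diagLin T x)
      (y := ((‖T‖ : ℂ) • x : CountableSum H)) (diag_norm_le T x)
    rwa [norm_smul, Complex.norm_real, norm_norm] at h

theorem diagOp_apply (T : H →L[ℂ] H) (x : CountableSum H) (n : ℕ) : diagOp T x n = T (x n) := rfl

variable [CompleteSpace H] [CompleteSpace H']

/-- The `*`-representation `σ` embeds into the `*`-representation `τ`: there is a linear isometry
(not necessarily onto) intertwining the two. -/
def Embeds (σ : A →⋆ₐ[ℂ] (H →L[ℂ] H)) (τ : A →⋆ₐ[ℂ] (H' →L[ℂ] H')) : Prop :=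
  ∃ V : H →ₗᵢ[ℂ] H', ∀ (a : A) (x : H), V (σ a x) = τ a (V x)

/-- The restriction of a `*`-representation to an invariant (complete) subspace. -/
def subrep (σ : A →⋆ₐ[ℂ] (H →L[ℂ] H)) (S : Submodule ℂ H) [CompleteSpace S]
    (hS : ∀ (a : A), ∀ x ∈ S, σ a x ∈ S) : A →⋆ₐ[ℂ] (S →L[ℂ] S) where
  toFun a := (σ a).restrict (hS a)
  map_one' := by ext x; simp
  map_mul' a b := by ext x; simp
  map_zero' := by ext x; simp
  map_add' a b := by ext x; simp
  commutes' r := by ext x; simp [Algebra.algebraMap_eq_smul_one]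
  map_star' a := by
    rw [ContinuousLinearMap.star_eq_adjoint, ContinuousLinearMap.eq_adjoint_iff]
    intro x y
    change inner ℂ (σ (star a) (x : H)) (y : H) = inner ℂ (x : H) (σ a (y : H))
    rw [map_star, ContinuousLinearMap.star_eq_adjoint, ContinuousLinearMap.adjoint_inner_left]

/-- The direct sum `σ^{⊕ℕ}` of countably many copies of a `*`-representation. -/
def countableSumRep (σ : A →⋆ₐ[ℂ] (H →L[ℂ] H)) :
    A →⋆ₐ[ℂ] (CountableSum H →L[ℂ] CountableSum H) where
  toFun a := diagOp (σ a)
  map_one' := by ext x n; simp [diagOp_apply]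
  map_mul' a b := by ext x n; simp [diagOp_apply]
  map_zero' := by ext x n; simp [diagOp_apply]
  map_add' a b := by ext x n; simp [diagOp_apply]
  commutes' r := by ext x n; simp [diagOp_apply, Algebra.algebraMap_eq_smul_one]
  map_star' a := by
    rw [ContinuousLinearMap.star_eq_adjoint, ContinuousLinearMap.eq_adjoint_iff]
    intro x y
    rw [lp.inner_eq_tsum, lp.inner_eq_tsum]
    refine tsum_congr fun n => ?_
    change inner ℂ (σ (star a) (x n)) (y n) = inner ℂ (x n) (σ a (y n))
    rw [map_star, ContinuousLinearMap.star_eq_adjoint, ContinuousLinearMap.adjoint_inner_left]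

end Operations

section Koopman

variable {G : Type*} [Group G] {X Y : Type*} [MeasurableSpace Y] [MulAction G Y]
  [MeasurableSpace X] [MulAction G X] [MeasurableConstSMul G Y]
  {φ : X → Y} {μ : Measure X} {ν : Measure Y} [SMulInvariantMeasure G Y ν]

namespace IsFactorMap

/-- The generalized Koopman representation of `L^∞_ν(Y) ⋊ G` on `L²_μ(X)`:
`(ρ(s u_g) f) x = s (φ x) * f (g⁻¹ • x)`. -/
def koopmanRep (h : IsFactorMap G φ μ ν) :
    CrossedProduct G ν →⋆ₐ[ℂ] (Lp ℂ 2 μ →L[ℂ] Lp ℂ 2 μ) :=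
  h.isEquivariantOver.rep

/-- `L²_ν(Y)` viewed as a subspace of `L²_μ(X)` through `f ↦ f ∘ φ`. -/
def L2Base (h : IsFactorMap G φ μ ν) : Submodule ℂ (Lp ℂ 2 μ) :=
  LinearMap.range (Lp.compMeasurePreservingₗᵢ ℂ φ h.map_preserving (E := ℂ) (p := 2)).toLinearMap

theorem koopmanRep_single_mem (h : IsFactorMap G φ μ ν) (g : G) (s : Linfty ν) {f : Lp ℂ 2 μ}
    (hf : f ∈ h.L2Base) : h.koopmanRep (SkewMonoidAlgebra.single g s) f ∈ h.L2Base := by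
  obtain ⟨f, rfl⟩ := hf
  have hY : IsEquivariantOver G (id : Y → Y) ν ν :=
    ⟨fun g => measurePreserving_smul g ν, .id ν, fun _ _ => rfl⟩
  refine ⟨hY.rep (SkewMonoidAlgebra.single g s) f, ?_⟩
  have hc : ∀ f : Lp ℂ 2 ν, ⇑(Lp.compMeasurePreservingₗᵢ ℂ φ h.map_preserving f) =ᵐ[μ]
      fun x => f (φ x) := fun f => Lp.coeFn_compMeasurePreserving _ _
  apply Lp.ext
  refine (hc _).trans ?_
  filter_upwards [h.isEquivariantOver.coeFn_rep_single g s
      (Lp.compMeasurePreservingₗᵢ ℂ φ h.map_preserving f),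
    h.isEquivariantOver.ae_smul g (hc f),
    h.isEquivariantOver.quasi.ae (hY.coeFn_rep_single g s f)] with x h1 h2 h3
  refine h3.trans (Eq.trans ?_ h1.symm)
  rw [h2, h.equivariant, id]

theorem koopmanRep_mem (h : IsFactorMap G φ μ ν) (a : CrossedProduct G ν) {f : Lp ℂ 2 μ}
    (hf : f ∈ h.L2Base) : h.koopmanRep a f ∈ h.L2Base := by
  induction a using SkewMonoidAlgebra.induction_on with
  | zero => rw [map_zero]; exact zero_mem _
  | single g s => exact h.koopmanRep_single_mem g s hf
  | add a b ha hb => rw [map_add]; exact add_mem ha hb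

theorem koopmanRep_mem_orthogonal (h : IsFactorMap G φ μ ν) (a : CrossedProduct G ν)
    (f : Lp ℂ 2 μ) (hf : f ∈ h.L2Baseᗮ) : h.koopmanRep a f ∈ h.L2Baseᗮ := by
  rw [Submodule.mem_orthogonal]
  intro f' hf'
  rw [← ContinuousLinearMap.adjoint_inner_left, ← ContinuousLinearMap.star_eq_adjoint, ← map_star]
  exact (Submodule.mem_orthogonal _ _).1 hf _ (h.koopmanRep_mem _ hf')

/-- The restriction of the generalized Koopman representation to `L²_μ(X) ⊖ L²_ν(Y)`. -/
def koopmanRepCompl (h : IsFactorMap G φ μ ν) :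
    CrossedProduct G ν →⋆ₐ[ℂ] (h.L2Baseᗮ →L[ℂ] h.L2Baseᗮ) :=
  subrep h.koopmanRep h.L2Baseᗮ h.koopmanRep_mem_orthogonal

end IsFactorMap

end Koopman

section Subgroups

variable {G : Type*} [Group G]

/-- The topology of `Sub(G)`: a base consists of the sets `{H | H ∩ T = F}` with `F ⊆ T` finite. -/
instance : TopologicalSpace (Subgroup G) :=
  TopologicalSpace.generateFrom
    {U | ∃ T F : Set G, T.Finite ∧ F ⊆ T ∧ U = {H : Subgroup G | (H : Set G) ∩ T = F}}

/-- The Borel `σ`-algebra of `Sub(G)`. -/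
instance : MeasurableSpace (Subgroup G) := borel (Subgroup G)

instance : BorelSpace (Subgroup G) := ⟨rfl⟩

/-- The action of `G` on `Sub(G)` by conjugation, `g • H = g H g⁻¹`. -/
instance : MulAction G (Subgroup G) where
  smul g H := H.map (MulAut.conj g).toMonoidHom
  one_smul H := by
    change H.map (MulAut.conj (1 : G)).toMonoidHom = H
    ext x; simp
  mul_smul g h H := by
    change H.map (MulAut.conj (g * h)).toMonoidHom =
      (H.map (MulAut.conj h).toMonoidHom).map (MulAut.conj g).toMonoidHom
    rw [Subgroup.map_map, map_mul]; rfl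

theorem mem_conj_iff (g : G) (H : Subgroup G) (x : G) : x ∈ g • H ↔ g⁻¹ * x * g ∈ H := by
  change x ∈ H.map (MulAut.conj g).toMonoidHom ↔ _
  rw [Subgroup.mem_map]
  constructor
  · rintro ⟨y, hy, rfl⟩
    simpa [mul_assoc] using hy
  · intro h
    exact ⟨_, h, by simp [mul_assoc]⟩

theorem measurableSet_mem (g : G) : MeasurableSet {H : Subgroup G | g ∈ H} := by
  apply IsOpen.measurableSet
  apply TopologicalSpace.isOpen_generateFrom_of_mem
  refine ⟨{g}, {g}, Set.finite_singleton g, subset_rfl, ?_⟩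
  ext H
  simp [Set.inter_eq_right]

instance : MeasurableConstSMul G (Subgroup G) where
  measurable_const_smul g := by
    apply Continuous.measurable
    refine continuous_generateFrom_iff.2 ?_
    rintro _ ⟨T, F, hT, hF, rfl⟩
    apply TopologicalSpace.isOpen_generateFrom_of_mem
    refine ⟨(fun x => g⁻¹ * x * g) '' T, (fun x => g⁻¹ * x * g) '' F, hT.image _,
      Set.image_mono hF, ?_⟩
    have hinj : Function.Injective (fun x => g⁻¹ * x * g) := fun x y h => by simpa using h
    have hsurj : Function.Surjective (fun x => g⁻¹ * x * g) := fun x =>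
      ⟨g * x * g⁻¹, by simp [mul_assoc]⟩
    ext H
    have : (H : Set G) = (fun x => g⁻¹ * x * g) '' ((g • H : Subgroup G) : Set G) := by
      ext x
      obtain ⟨y, rfl⟩ := hsurj x
      simp [mem_conj_iff]
    simp only [Set.mem_preimage, Set.mem_ofPred_eq]
    rw [this, ← Set.image_inter hinj, hinj.image_injective.eq_iff]

/-- The set `Γ\G` of right cosets `Γ h`. -/
abbrev RightCosets (Γ : Subgroup G) : Type _ := Quotient (QuotientGroup.rightRel Γ)

/-- The right coset `Γ h`. -/
abbrev rightCoset (Γ : Subgroup G) (h : G) : RightCosets Γ := Quotient.mk _ h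

theorem rightCoset_eq_iff {Γ : Subgroup G} {h k : G} :
    rightCoset Γ h = rightCoset Γ k ↔ k * h⁻¹ ∈ Γ := by
  rw [Quotient.eq, QuotientGroup.rightRel_apply]

/-- Left multiplication `Γ h ↦ g Γ h = (g Γ g⁻¹) g h`, from `Γ\G` to `(g Γ g⁻¹)\G`. -/
def cosetSMul (g : G) {Γ Δ : Subgroup G} (hΔ : Δ = g • Γ) : RightCosets Γ ≃ RightCosets Δ where
  toFun := Quotient.map (fun h => g * h) fun h k hk => by
    change QuotientGroup.rightRel _ _ _ at hk
    change QuotientGroup.rightRel _ _ _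
    rw [QuotientGroup.rightRel_apply] at hk ⊢
    rw [hΔ, mem_conj_iff]
    simpa [mul_assoc] using hk
  invFun := Quotient.map (fun h => g⁻¹ * h) fun h k hk => by
    change QuotientGroup.rightRel _ _ _ at hk
    change QuotientGroup.rightRel _ _ _
    rw [QuotientGroup.rightRel_apply] at hk ⊢
    rw [hΔ, mem_conj_iff] at hk
    simpa [mul_assoc] using hk
  left_inv c := by
    induction c using Quotient.inductionOn with
    | h h => simp
  right_inv c := by
    induction c using Quotient.inductionOn with
    | h h => simp

theorem cosetSMul_rightCoset (g : G) {Γ Δ : Subgroup G} (hΔ : Δ = g • Γ) (h : G) :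
    cosetSMul g hΔ (rightCoset Γ h) = rightCoset Δ (g * h) := rfl

/-- For countable `G` one can choose representatives of right cosets measurably in the subgroup. -/
theorem exists_measurable_representatives (G : Type*) [Group G] [Countable G] :
    ∃ r : (Γ : Subgroup G) → RightCosets Γ → G,
      (∀ Γ c, rightCoset Γ (r Γ c) = c) ∧
      ∀ h k : G, MeasurableSet {Γ : Subgroup G | r Γ (rightCoset Γ h) = k} := by
  obtain ⟨e, he⟩ := Countable.exists_injective_nat G
  have hne : ∀ (Γ : Subgroup G) (c : RightCosets Γ), {h : G | rightCoset Γ h = c}.Nonempty :=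
    fun Γ c => ⟨c.out, Quotient.out_eq c⟩
  refine ⟨fun Γ c => Function.argminOn e {h : G | rightCoset Γ h = c} (hne Γ c), fun Γ c =>
    Function.argminOn_mem e {h : G | rightCoset Γ h = c} (hne Γ c), fun h k => ?_⟩
  have : {Γ : Subgroup G | Function.argminOn e {l : G | rightCoset Γ l = rightCoset Γ h}
      (hne Γ _) = k} = {Γ : Subgroup G | h * k⁻¹ ∈ Γ} ∩ ⋂ l : G, ⋂ (_ : ¬ e k ≤ e l),
        {Γ : Subgroup G | h * l⁻¹ ∈ Γ}ᶜ := by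
    ext Γ
    simp only [Set.mem_ofPred_eq, Set.mem_inter_iff, Set.mem_iInter, Set.mem_compl_iff,
      ← rightCoset_eq_iff]
    constructor
    · rintro rfl
      refine ⟨Function.argminOn_mem e _ (hne Γ _), fun l hl hl' => hl ?_⟩
      exact Function.argminOn_le e {l : G | rightCoset Γ l = rightCoset Γ h} hl'
    · rintro ⟨h1, h2⟩
      apply he
      apply le_antisymm
      · exact Function.argminOn_le e {l : G | rightCoset Γ l = rightCoset Γ h} h1
      · by_contra hcon
        exact h2 _ hcon (Function.argminOn_mem e {l : G | rightCoset Γ l = rightCoset Γ h}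
          (hne Γ _))
  rw [this]
  refine (measurableSet_mem _).inter ?_
  exact MeasurableSet.iInter fun l => MeasurableSet.iInter fun _ => (measurableSet_mem _).compl

end Subgroups

section CosetBundle

variable {G : Type*} [Group G] {Z : Type*} [MulAction G Z]

/-- For an equivariant family `z ↦ Γ_z` of subgroups, the set of all pairs `(z, c)` with
`c ∈ Γ_z\G`. -/
@[ext]
structure CosetBundle (Γ : Z →[G] Subgroup G) where
  /-- The base point `z`. -/
  base : Z
  /-- The right coset `c ∈ Γ_z\G`. -/
  coset : RightCosets (Γ base)

namespace CosetBundle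

variable {Γ : Z →[G] Subgroup G}

/-- The section `z ↦ (z, Γ_z h)`. -/
def sec (Γ : Z →[G] Subgroup G) (h : G) (z : Z) : CosetBundle Γ := ⟨z, rightCoset (Γ z) h⟩

theorem exists_sec (x : CosetBundle Γ) : ∃ h : G, x = sec Γ h x.base := by
  obtain ⟨z, c⟩ := x
  obtain ⟨h, rfl⟩ := Quotient.exists_rep c
  exact ⟨h, rfl⟩

instance : SMul G (CosetBundle Γ) where
  smul g x := ⟨g • x.base, cosetSMul g (map_smul Γ g x.base) x.coset⟩

theorem smul_base (g : G) (x : CosetBundle Γ) : (g • x).base = g • x.base := rfl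

theorem smul_sec (g h : G) (z : Z) : g • sec Γ h z = sec Γ (g * h) (g • z) := rfl

/-- The action `g • (z, Γ_z h) = (g • z, g Γ_z h)`, where `g Γ_z h = Γ_{g • z} g h`. -/
instance : MulAction G (CosetBundle Γ) where
  one_smul x := by
    obtain ⟨h, hx⟩ := exists_sec x
    rw [hx, smul_sec, one_mul, one_smul]
  mul_smul g k x := by
    obtain ⟨h, hx⟩ := exists_sec x
    rw [hx, smul_sec, smul_sec, smul_sec, mul_assoc, mul_smul]

variable [MeasurableSpace Z]

/-- A subset of the bundle is measurable if its pullback along each of the sections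
`z ↦ (z, Γ_z h)`, `h ∈ G`, is.  So a complex function `f` on the bundle is measurable exactly if
all the functions `z ↦ f (z, Γ_z h) = ⟨f z, δ_{Γ_z h}⟩` are: these are the measurable fields of
vectors for the field of Hilbert spaces `z ↦ ℓ²(Γ_z\G)` with fundamental sections
`z ↦ δ_{Γ_z h}`. -/
instance : MeasurableSpace (CosetBundle Γ) :=
  ⨅ h : G, MeasurableSpace.map (sec Γ h) inferInstance

theorem measurableSet_iff {A : Set (CosetBundle Γ)} :
    MeasurableSet A ↔ ∀ h : G, MeasurableSet (sec Γ h ⁻¹' A) :=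
  MeasurableSpace.measurableSet_iInf

theorem measurable_iff {β : Type*} [MeasurableSpace β] {f : CosetBundle Γ → β} :
    Measurable f ↔ ∀ h : G, Measurable fun z => f (sec Γ h z) := by
  constructor
  · intro hf h s hs
    exact measurableSet_iff.1 (hf hs) h
  · intro hf s hs
    exact measurableSet_iff.2 fun h => hf h hs

theorem measurable_sec (h : G) : Measurable (sec Γ h) := fun _ hs => measurableSet_iff.1 hs h

theorem measurable_base : Measurable (base : CosetBundle Γ → Z) :=
  measurable_iff.2 fun _ => measurable_id

/-- Summation over the fibres `Γ_z\G` followed by integration over the base: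
`∫ ∑_{c ∈ Γ_z\G} δ_{(z, c)} dω(z)`. -/
def measure (Γ : Z →[G] Subgroup G) (ω : Measure Z) : Measure (CosetBundle Γ) :=
  ω.bind fun z => Measure.sum fun c : RightCosets (Γ z) => Measure.dirac (⟨z, c⟩ : CosetBundle Γ)

theorem measurable_tsum [Countable G] (hΓ : Measurable Γ) {f : CosetBundle Γ → ℝ≥0∞}
    (hf : Measurable f) : Measurable fun z => ∑' c : RightCosets (Γ z), f ⟨z, c⟩ := by
  classical
  obtain ⟨r, hr, hrm⟩ := exists_measurable_representatives G
  have : (fun z => ∑' c : RightCosets (Γ z), f ⟨z, c⟩) = fun z => ∑' h : G,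
      {z : Z | r (Γ z) (rightCoset (Γ z) h) = h}.indicator (fun z => f (sec Γ h z)) z := by
    ext z
    have hinj : Function.Injective (r (Γ z)) := fun c d hcd => by
      rw [← hr (Γ z) c, ← hr (Γ z) d, hcd]
    rw [← hinj.tsum_eq]
    · refine tsum_congr fun c => ?_
      rw [Set.indicator_of_mem]
      · simp only [sec, hr]
      · change r (Γ z) (rightCoset (Γ z) (r (Γ z) c)) = r (Γ z) c
        rw [hr]
    · intro h hh
      have := Set.mem_of_indicator_ne_zero hh
      exact ⟨_, this⟩
  rw [this]
  refine Measurable.tsum fun h => ?_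
  exact (hf.comp (measurable_sec h)).indicator (hΓ (hrm h h))

theorem measurable_fibreMeasure [Countable G] (hΓ : Measurable Γ) :
    Measurable fun z => Measure.sum fun c : RightCosets (Γ z) =>
      Measure.dirac (⟨z, c⟩ : CosetBundle Γ) := by
  refine Measure.measurable_of_measurable_coe _ fun s hs => ?_
  have : ∀ z, (Measure.sum fun c : RightCosets (Γ z) => Measure.dirac (⟨z, c⟩ : CosetBundle Γ)) s =
      ∑' c : RightCosets (Γ z), s.indicator 1 (⟨z, c⟩ : CosetBundle Γ) := fun z => by
    rw [Measure.sum_apply _ hs]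
    exact tsum_congr fun c => Measure.dirac_apply' _ hs
  simp only [this]
  exact measurable_tsum hΓ (measurable_one.indicator hs)

/-- In particular the square of the norm of `f` in `L²` of the bundle is `∫ ‖f z‖² dω(z)`, the norm
of `f z` being that of `ℓ²(Γ_z\G)`. -/
theorem lintegral_measure [Countable G] (hΓ : Measurable Γ) (ω : Measure Z)
    {f : CosetBundle Γ → ℝ≥0∞} (hf : Measurable f) :
    ∫⁻ x, f x ∂(measure Γ ω) = ∫⁻ z, ∑' c : RightCosets (Γ z), f ⟨z, c⟩ ∂ω := by
  rw [measure, Measure.lintegral_bind (measurable_fibreMeasure hΓ).aemeasurable hf.aemeasurable]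
  refine lintegral_congr fun z => ?_
  rw [lintegral_sum_measure]
  exact tsum_congr fun c => lintegral_dirac' _ hf

theorem measurable_smul {g : G} (hg : Measurable fun z : Z => g • z) :
    Measurable fun x : CosetBundle Γ => g • x :=
  measurable_iff.2 fun h => (measurable_sec (g * h)).comp hg

theorem measurePreserving_smul [Countable G] (hΓ : Measurable Γ)
    {ω : Measure Z} (g : G) (hω : MeasurePreserving (fun z : Z => g • z) ω ω) :
    MeasurePreserving (fun x : CosetBundle Γ => g • x) (measure Γ ω) (measure Γ ω) := by
  refine ⟨measurable_smul hω.measurable, Measure.ext fun s hs => ?_⟩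
  have hs1 : Measurable (s.indicator (1 : CosetBundle Γ → ℝ≥0∞)) := measurable_one.indicator hs
  rw [← lintegral_indicator_one hs, lintegral_map hs1 (measurable_smul hω.measurable),
    ← lintegral_indicator_one hs]
  refine (lintegral_measure hΓ ω (hs1.comp (measurable_smul hω.measurable))).trans ?_
  rw [lintegral_measure hΓ ω hs1, ← hω.lintegral_comp (measurable_tsum hΓ hs1)]
  refine lintegral_congr fun z => ?_
  exact (cosetSMul g (map_smul Γ g z)).tsum_eq
    (fun c => s.indicator (1 : CosetBundle Γ → ℝ≥0∞) ⟨g • z, c⟩)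

theorem quasiMeasurePreserving_base [Countable G] (hΓ : Measurable Γ) (ω : Measure Z) :
    Measure.QuasiMeasurePreserving (base : CosetBundle Γ → Z) (measure Γ ω) ω := by
  refine ⟨measurable_base, Measure.AbsolutelyContinuous.mk fun s hs h0 => ?_⟩
  rw [Measure.map_apply measurable_base hs, ← lintegral_indicator_one (measurable_base hs),
    lintegral_measure hΓ ω (measurable_one.indicator (measurable_base hs))]
  rw [lintegral_eq_zero_iff (measurable_tsum hΓ (measurable_one.indicator (measurable_base hs)))]
  filter_upwards [measure_eq_zero_iff_ae_notMem.1 h0] with z hz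
  simp [hz]

end CosetBundle

end CosetBundle

section LeftRegular

variable {G : Type*} [Group G] [Countable G] {Y Z : Type*} [MeasurableSpace Y] [MulAction G Y]
  [MeasurableSpace Z] [MulAction G Z]
  {π : Z → Y} {ω : Measure Z} {ν : Measure Y}

theorem IsFactorMap.cosetBundle (h : IsFactorMap G π ω ν) {Γ : Z →[G] Subgroup G}
    (hΓ : Measurable Γ) :
    IsEquivariantOver G (fun x : CosetBundle Γ => π x.base) (CosetBundle.measure Γ ω) ν where
  smul_preserving g := CosetBundle.measurePreserving_smul hΓ g (h.smul_preserving g)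
  quasi := h.map_preserving.quasiMeasurePreserving.comp
    (CosetBundle.quasiMeasurePreserving_base hΓ ω)
  equivariant g x := h.equivariant g x.base

/-- The direct integral `∫^⊕ ℓ²(Γ_z\G) dω(z)`: the (classes of) measurable functions
`f (z, c)` of `z ∈ Z` and `c ∈ Γ_z\G` with `∫ ∑_{c ∈ Γ_z\G} |f (z, c)|² dω(z) < ∞`. -/
abbrev DirectIntegral (Γ : Z →[G] Subgroup G) (ω : Measure Z) : Type _ :=
  Lp ℂ 2 (CosetBundle.measure Γ ω)

/-- The generalized left-regular representation of `L^∞_ν(Y) ⋊ G` on `∫^⊕ ℓ²(Γ_z\G) dω(z)`, where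
`π : (Z, ω) → (Y, ν)` is a factor map and `z ↦ Γ_z` is equivariant and measurable:
`(λ(s u_g) f) (z, Γ_z h) = s (π z) * f (g⁻¹ • z, g⁻¹ Γ_z h)`. -/
def leftRegularRep [MeasurableConstSMul G Y] [SMulInvariantMeasure G Y ν] (h : IsFactorMap G π ω ν) {Γ : Z →[G] Subgroup G} (hΓ : Measurable Γ) :
    CrossedProduct G ν →⋆ₐ[ℂ] (DirectIntegral Γ ω →L[ℂ] DirectIntegral Γ ω) :=
  (h.cosetBundle hΓ).rep

end LeftRegular

section Bernoulli

variable {G K : Type*} [Group G] [MeasurableSpace K]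

/-- The space `K^G`. -/
def ShiftSpace (G K : Type*) : Type _ := G → K

instance : MeasurableSpace (ShiftSpace G K) := inferInstanceAs (MeasurableSpace (G → K))

/-- The left shift action `(g • x) t = x (g⁻¹ t)` of `G` on `K^G`. -/
instance : MulAction G (ShiftSpace G K) where
  smul g x := fun t => x (g⁻¹ * t)
  one_smul x := funext fun t => congrArg x (by simp)
  mul_smul g h x := funext fun t => congrArg x (by simp [mul_assoc])

instance : MeasurableConstSMul G (ShiftSpace G K) where
  measurable_const_smul g := measurable_pi_lambda (fun (x : G → K) t => x (g⁻¹ * t))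
    fun t => measurable_pi_apply (g⁻¹ * t)

/-- A point of `K^{Γ\G}` viewed as a point of `K^G`, namely a function constant on right cosets
of `Γ`. -/
def ofCosets (Γ : Subgroup G) (w : RightCosets Γ → K) : ShiftSpace G K :=
  fun t => w (rightCoset Γ t)

theorem measurable_ofCosets (Γ : Subgroup G) : Measurable (ofCosets (K := K) Γ) :=
  measurable_pi_lambda (fun (w : RightCosets Γ → K) (t : G) => w (rightCoset Γ t))
    fun _ => measurable_pi_apply _

/-- The measure `κ^{Γ\G}`, viewed as a measure on `K^G`. -/
def bernoulli (κ : Measure K) (Γ : Subgroup G) : Measure (ShiftSpace G K) :=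
  (Measure.infinitePi fun _ : RightCosets Γ => κ).map (ofCosets Γ)

variable (κ : Measure K) [IsProbabilityMeasure κ]

instance (Γ : Subgroup G) : IsProbabilityMeasure (bernoulli κ Γ) :=
  Measure.isProbabilityMeasure_map (measurable_ofCosets Γ).aemeasurable

theorem map_infinitePi_reindex {ι ι' : Type*} {e : ι → ι'} (he : Function.Injective e) :
    (Measure.infinitePi fun _ : ι' => κ).map (fun w i => w (e i)) =
      Measure.infinitePi fun _ : ι => κ := by
  classical
  refine Measure.eq_infinitePi _ fun s t ht => ?_
  rw [Measure.map_apply (by fun_prop) (.pi s.countable_toSet fun _ _ => ht _)]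
  have : (fun (w : ι' → K) i => w (e i)) ⁻¹' ((s : Set ι).pi t) =
      ((s.image e : Finset ι') : Set ι').pi (fun j => ⋂ (i : ι) (_ : e i = j), t i) := by
    ext w
    simp only [Set.mem_preimage, Set.mem_pi, Finset.coe_image, Set.mem_image, Set.mem_iInter,
      forall_exists_index, and_imp, forall_apply_eq_imp_iff₂]
    constructor
    · intro h i hi j hj
      have := he hj
      subst this
      exact h j hi
    · intro h i hi
      exact h i hi i rfl
  have key : ∀ i, ⋂ (j : ι) (_ : e j = e i), t j = t i := fun i => by
    ext x
    simp only [Set.mem_iInter]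
    exact ⟨fun h => h i rfl, fun h j hj => by rwa [he hj]⟩
  rw [this, Measure.infinitePi_pi, Finset.prod_image he.injOn]
  · simp only [key]
  · intro j hj
    obtain ⟨i, _, rfl⟩ := Finset.mem_image.1 hj
    rw [key]
    exact ht i

theorem bernoulli_map_smul (g : G) (Γ : Subgroup G) :
    (bernoulli κ Γ).map (fun x => g • x) = bernoulli κ (g • Γ) := by
  rw [bernoulli, Measure.map_map (measurable_const_smul g) (measurable_ofCosets Γ), bernoulli,
    ← map_infinitePi_reindex κ (cosetSMul g (rfl : g • Γ = g • Γ)).injective,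
    Measure.map_map ((measurable_const_smul g).comp (measurable_ofCosets Γ)) (by fun_prop)]
  congr 1
  refine funext fun w => funext fun t => ?_
  change w (cosetSMul g _ (rightCoset Γ (g⁻¹ * t))) = w (rightCoset (g • Γ) t)
  rw [cosetSMul_rightCoset, mul_inv_cancel_left]

theorem measurable_bernoulli [Countable G] :
    Measurable fun Γ : Subgroup G => bernoulli κ Γ := by
  obtain ⟨r, hr, hrm⟩ := exists_measurable_representatives G
  have h1 : ∀ Γ : Subgroup G, bernoulli κ Γ = (Measure.infinitePi fun _ : G => κ).map
      (fun w t => w (r Γ (rightCoset Γ t))) := fun Γ => by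
    have hinj : Function.Injective (r Γ) := fun c d hcd => by
      rw [← hr Γ c, ← hr Γ d, hcd]
    rw [bernoulli, ← map_infinitePi_reindex κ hinj,
      Measure.map_map (measurable_ofCosets Γ) (by fun_prop)]
    rfl
  have h2 : Measurable fun p : Subgroup G × (G → K) =>
      (fun t => p.2 (r p.1 (rightCoset p.1 t)) : G → K) := by
    refine measurable_pi_lambda _ fun t => ?_
    intro s hs
    have : (fun p : Subgroup G × (G → K) => p.2 (r p.1 (rightCoset p.1 t))) ⁻¹' s =
        ⋃ k : G, {p : Subgroup G × (G → K) | r p.1 (rightCoset p.1 t) = k} ∩ {p | p.2 k ∈ s} := by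
      ext p
      simp
    rw [this]
    refine MeasurableSet.iUnion fun k => ?_
    exact (measurable_fst (hrm t k)).inter (((measurable_pi_apply k).comp measurable_snd) hs)
  refine Measure.measurable_of_measurable_coe _ fun s hs => ?_
  have h3 : ∀ Γ : Subgroup G, bernoulli κ Γ s = (Measure.infinitePi fun _ : G => κ)
      (Prod.mk Γ ⁻¹' ((fun p : Subgroup G × (G → K) =>
        (fun t => p.2 (r p.1 (rightCoset p.1 t)) : G → K)) ⁻¹' s)) := fun Γ => by
    rw [h1]
    exact Measure.map_apply (h2.comp measurable_prodMk_left) hs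
  simp only [h3]
  exact measurable_measure_prodMk_left (h2 hs)

variable {Y Z : Type*} [MeasurableSpace Y] [MeasurableSpace Z]

/-- The measure `∫ κ^{Γ_z\G} × δ_{π z} dω(z)` on `K^G × Y`. -/
def extensionMeasure (Γ : Z → Subgroup G) (π : Z → Y) (ω : Measure Z) :
    Measure (ShiftSpace G K × Y) :=
  ω.bind fun z => (bernoulli κ (Γ z)).prod (Measure.dirac (π z))

theorem measurable_bernoulli_prod_dirac [Countable G] {Γ : Z → Subgroup G} (hΓ : Measurable Γ)
    {π : Z → Y} (hπ : Measurable π) :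
    Measurable fun z => (bernoulli κ (Γ z)).prod (Measure.dirac (π z)) := by
  let k₁ : ProbabilityTheory.Kernel Z (ShiftSpace G K) :=
    ⟨fun z => bernoulli κ (Γ z), (measurable_bernoulli κ).comp hΓ⟩
  have : ProbabilityTheory.IsMarkovKernel k₁ :=
    ⟨fun z => inferInstanceAs (IsProbabilityMeasure (bernoulli κ (Γ z)))⟩
  have h := (k₁.prod (ProbabilityTheory.Kernel.deterministic π hπ)).measurable
  convert h using 2 with z
  rw [ProbabilityTheory.Kernel.prod_apply, ProbabilityTheory.Kernel.deterministic_apply]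
  rfl

/-- The projection `K^G × Y → Y` is a factor map from the non-free Bernoulli extension. -/
theorem IsFactorMap.extension [Countable G] [MulAction G Y] [MeasurableConstSMul G Y]
    [MulAction G Z] {π : Z → Y} {ω : Measure Z} {ν : Measure Y} (h : IsFactorMap G π ω ν)
    {Γ : Z →[G] Subgroup G} (hΓ : Measurable Γ) :
    IsFactorMap G (Prod.snd : ShiftSpace G K × Y → Y) (extensionMeasure κ Γ π ω) ν where
  smul_preserving g := by
    have hk := measurable_bernoulli_prod_dirac κ hΓ h.map_preserving.measurable
    have hg : Measurable fun x : ShiftSpace G K × Y => g • x :=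
      ((measurable_const_smul g).comp measurable_fst).prodMk
        ((measurable_const_smul g).comp measurable_snd)
    refine ⟨hg, Measure.ext fun s hs => ?_⟩
    rw [Measure.map_apply hg hs, extensionMeasure,
      Measure.bind_apply (hg hs) hk.aemeasurable, Measure.bind_apply hs hk.aemeasurable]
    refine Eq.trans (lintegral_congr fun z => ?_)
      ((h.smul_preserving g).lintegral_comp ((Measure.measurable_coe hs).comp hk))
    have hd : Measure.dirac (g • π z) = (Measure.dirac (π z)).map (fun y : Y => g • y) :=
      (Measure.map_dirac' (measurable_const_smul g) _).symm
    rw [map_smul, h.equivariant, ← bernoulli_map_smul, hd, Measure.map_prod_map _ _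
        (measurable_const_smul g) (measurable_const_smul g)]
    exact (Measure.map_apply hg hs).symm
  map_preserving := by
    have hk := measurable_bernoulli_prod_dirac κ hΓ h.map_preserving.measurable
    refine ⟨measurable_snd, Measure.ext fun s hs => ?_⟩
    rw [Measure.map_apply measurable_snd hs, extensionMeasure,
      Measure.bind_apply (measurable_snd hs) hk.aemeasurable, ← h.map_preserving.map_eq,
      Measure.map_apply h.map_preserving.measurable hs,
      ← lintegral_indicator_one (h.map_preserving.measurable hs)]
    refine lintegral_congr fun z => ?_
    rw [← Measure.map_apply measurable_snd hs, Measure.map_snd_prod]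
    simp only [measure_univ, one_smul, Measure.dirac_apply' _ hs]
    rfl
  equivariant _ _ := rfl

end Bernoulli

section FactorMaps

variable {G : Type*} [Group G] {Y : Type*} [MeasurableSpace Y] [MulAction G Y] (ν : Measure Y)

/-- The identity map as a factor map. -/
theorem isFactorMap_id [MeasurableConstSMul G Y] [SMulInvariantMeasure G Y ν] : IsFactorMap G (id : Y → Y) ν ν :=
  ⟨fun g => measurePreserving_smul g ν, .id ν, fun _ _ => rfl⟩

variable {ν}

/-- The projection `Sub(G) × Y → Y` as a factor map. -/
theorem isFactorMap_snd {ω : Measure (Subgroup G × Y)}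
    (hω : ∀ g : G, MeasurePreserving (fun p : Subgroup G × Y => g • p) ω ω)
    (hproj : MeasurePreserving Prod.snd ω ν) :
    IsFactorMap G (Prod.snd : Subgroup G × Y → Y) ω ν :=
  ⟨hω, hproj, fun _ _ => rfl⟩

end FactorMaps

end NonfreeBernoulli

end

/-!
Fix a bounded function `ξ` on `K` of mean `0` and variance `1`; by non-triviality of `κ` a
normalized indicator function will do.  For a subgroup `Γ` the Walsh functions
`w ↦ ∏_{c ∈ T} ξ (w c)`, `T ⊆ Γ\G` finite, are orthonormal in `L²(κ^{Γ\G})`, and those with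
`T ≠ ∅` are orthogonal to the constants.  Left multiplication by `g` carries them to the Walsh
functions for `g Γ g⁻¹`.

Both parts are instances of one situation: a factor map `π : (Z, ω) → (Y, ν)`, an equivariant field
`z ↦ Γ_z` of subgroups, and the extension `∫ κ^{Γ_z\G} × δ_{π z} dω(z)`, where `Z = Y` in the first
and `Z = Sub(G) × Y` in the second.  For each `n` attach to a coset `c ∈ Γ_z\G` the vector
`v_n(c) = ∑_T q(c, T) · (Walsh function of T)`, summed over the sets `T ∋ c` of `n + 1` cosets, with
positive coefficients `q(c, T) = ∑_{P : c P = T} u_P`, where `u` is a summable positive weight on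
the finite subsets `P` of `G`.  This family is equivariant, and `F ↦ (⟨F, v_n(c)⟩)_c` is a bounded
intertwiner `S_n` from `L²` of the extension to the direct integral (`tsum_sq_patternCoeff_le`,
`exists_patternOp`, `patternOp_koopmanRep`).  It annihilates `L²_ν(Y)`, and for different `n` the
vectors live on different Walsh levels.

If `f` is orthogonal to the range of `S_n`, then testing against Walsh functions gives, for almost
every `z`, `∑_{c ∈ T} q(c, T) f(z, c) = 0` for every set `T` of `n + 1` cosets.  As `Γ_z\G` is
infinite and the weights are positive, `f = 0` (`eq_zero_of_forall_weighted_sum_eq_zero`).  Hence the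
adjoint of the (suitably scaled) sum of the `S_n` is an injective bounded intertwiner from
`λ^{⊕ℕ}` to `ρ` restricted to the complement of `L²_ν(Y)`, and the isometric factor of its polar
decomposition is the required embedding (`Embeds.of_injective`).

In the second part the test functions have to depend on the subgroup, which is not a coordinate of
`K^G × Y`.  But for `Γ` of infinite index almost every point of `(K^G, κ^{Γ\G})` has exactly `Γ` as
its group of left periods (`ae_periods_eq`).
-/

noncomputable section

namespace NonfreeBernoulli

/-! ### Embedding a representation by polar decomposition -/

section CountableSum

variable {H : Type*} [NormedAddCommGroup H] [InnerProductSpace ℂ H]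
  {H' : Type*} [NormedAddCommGroup H'] [InnerProductSpace ℂ H']

/-- Countably many bounded operators, each with a scalar weight making their norms square
summable, assembled into one operator into the Hilbert sum. -/
theorem exists_countableSum_operator (S : ℕ → H' →L[ℂ] H) :
    ∃ (w : ℕ → ℂ) (R : H' →L[ℂ] CountableSum H), (∀ n, w n ≠ 0) ∧
      ∀ x n, R x n = w n • S n x := by
  set w : ℕ → ℝ := fun n => (1 / 2) ^ n / (1 + ‖S n‖) with hw
  have hpos : ∀ n, 0 < w n := fun n => by positivity
  have hle : ∀ n x, ‖(w n : ℂ) • S n x‖ ≤ (1 / 2) ^ n * ‖x‖ := fun n x => by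
    rw [norm_smul, Complex.norm_real, Real.norm_of_nonneg (hpos n).le]
    calc w n * ‖S n x‖ ≤ w n * (‖S n‖ * ‖x‖) := by gcongr; exact (S n).le_opNorm x
      _ ≤ w n * ((1 + ‖S n‖) * ‖x‖) := by gcongr; linarith
      _ = (1 / 2) ^ n * ‖x‖ := by rw [hw]; field_simp
  have hsum : ∀ (x : H') (s : Finset ℕ),
      ∑ n ∈ s, ‖(w n : ℂ) • S n x‖ ^ (2 : ℝ≥0∞).toReal ≤ (2 * ‖x‖) ^ (2 : ℝ≥0∞).toReal := by
    intro x s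
    simp only [ENNReal.toReal_ofNat, Real.rpow_ofNat]
    calc ∑ n ∈ s, ‖(w n : ℂ) • S n x‖ ^ 2 ≤ ∑ n ∈ s, ((1 / 2) ^ n * ‖x‖) ^ 2 := by
          gcongr with n; exact hle n x
      _ ≤ ∑ n ∈ s, (1 / 2) ^ n * ‖x‖ ^ 2 := by
          gcongr with n
          rw [mul_pow]
          gcongr
          have h1 : ((1 : ℝ) / 2) ^ n ≤ 1 := pow_le_one₀ (by norm_num) (by norm_num)
          have h0 : (0 : ℝ) ≤ (1 / 2) ^ n := by positivity
          nlinarith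
      _ = (∑ n ∈ s, (1 / 2) ^ n) * ‖x‖ ^ 2 := by rw [Finset.sum_mul]
      _ ≤ 2 * ‖x‖ ^ 2 := by
          gcongr
          exact (summable_geometric_two.sum_le_tsum s fun n _ => by positivity).trans_eq
            tsum_geometric_two
      _ ≤ (2 * ‖x‖) ^ 2 := by nlinarith [sq_nonneg ‖x‖]
  let R₀ : H' →ₗ[ℂ] CountableSum H :=
    { toFun := fun x => ⟨fun n => (w n : ℂ) • S n x, memℓp_gen' (hsum x)⟩
      map_add' := fun x y => lp.ext (funext fun n => by
        change (w n : ℂ) • S n (x + y) = (w n : ℂ) • S n x + (w n : ℂ) • S n y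
        rw [map_add, smul_add])
      map_smul' := fun r x => lp.ext (funext fun n => by
        change (w n : ℂ) • S n (r • x) = r • ((w n : ℂ) • S n x)
        rw [map_smul, smul_comm]) }
  refine ⟨fun n => (w n : ℂ), R₀.mkContinuous 2 fun x => ?_, fun n => ?_, fun x n => rfl⟩
  · exact lp.norm_le_of_forall_sum_le (by norm_num) (by positivity) (hsum x)
  · exact Complex.ofReal_ne_zero.2 (hpos n).ne'

end CountableSum

section Polar

variable {A : Type*} [Semiring A] [Algebra ℂ A] [Star A]
  {H : Type*} [NormedAddCommGroup H] [InnerProductSpace ℂ H] [CompleteSpace H]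
  {H' : Type*} [NormedAddCommGroup H'] [InnerProductSpace ℂ H'] [CompleteSpace H']

/-- An injective bounded intertwiner `T` yields an embedding, namely the isometric factor of the
polar decomposition `T = U |T|`: as `|T|` is self-adjoint and injective its range is dense, and it
commutes with the representation because `T^* T` does. -/
theorem Embeds.of_injective {σ : A →⋆ₐ[ℂ] (H →L[ℂ] H)} {τ : A →⋆ₐ[ℂ] (H' →L[ℂ] H')}
    (T : H →L[ℂ] H') (hT : Function.Injective T) (h : ∀ a x, T (σ a x) = τ a (T x)) :
    Embeds σ τ := by
  set P : H →L[ℂ] H := T.adjoint ∘L T with hPdef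
  have hP : 0 ≤ P := by
    rw [ContinuousLinearMap.nonneg_iff_isPositive]
    exact ContinuousLinearMap.isPositive_adjoint_comp_self T
  set B : H →L[ℂ] H := CFC.sqrt P with hBdef
  have hBB : B * B = P := CFC.sqrt_mul_sqrt_self P hP
  have hBsa : IsSelfAdjoint B := (CFC.sqrt_nonneg P).isSelfAdjoint
  have hBadj : B.adjoint = B := hBsa
  have hnorm : ∀ x, ‖B x‖ = ‖T x‖ := fun x => by
    have e : inner ℂ (B x) (B x) = inner ℂ (T x) (T x) := by
      rw [← ContinuousLinearMap.adjoint_inner_left B, hBadj]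
      change inner ℂ ((B * B) x) x = _
      rw [hBB]
      exact ContinuousLinearMap.adjoint_inner_left T x (T x)
    rw [inner_self_eq_norm_sq_to_K, inner_self_eq_norm_sq_to_K] at e
    have e' : ‖B x‖ ^ 2 = ‖T x‖ ^ 2 := by exact_mod_cast e
    exact (sq_eq_sq₀ (norm_nonneg _) (norm_nonneg _)).1 e'
  have hdense : DenseRange B := by
    have hr : B.rangeᗮ = ⊥ := by
      rw [B.orthogonal_range, hBadj, Submodule.eq_bot_iff]
      intro x hx
      have hBx : B x = 0 := hx
      have hTx : T x = 0 := by rw [← norm_eq_zero, ← hnorm, hBx, norm_zero]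
      exact hT (hTx.trans (map_zero T).symm)
    have := Submodule.topologicalClosure_eq_top_iff.2 hr
    have hd := Submodule.dense_iff_topologicalClosure_eq_top.2 this
    exact hd
  have hcomm : ∀ a, Commute B (σ a) := fun a => by
    have hPa : Commute P (σ a) := by
      change P * σ a = σ a * P
      have hadj : ∀ y, T.adjoint (τ a y) = σ a (T.adjoint y) := fun y => by
        refine ext_inner_right ℂ fun x => ?_
        rw [ContinuousLinearMap.adjoint_inner_left, ← ContinuousLinearMap.adjoint_inner_right (τ a),
          ← ContinuousLinearMap.adjoint_inner_right (σ a), ← ContinuousLinearMap.star_eq_adjoint,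
          ← ContinuousLinearMap.star_eq_adjoint, ← map_star, ← map_star, ← h,
          ContinuousLinearMap.adjoint_inner_left]
      ext x
      change T.adjoint (T (σ a x)) = σ a (T.adjoint (T x))
      rw [h, hadj]
    rw [hBdef, CFC.sqrt_eq_cfc]
    exact hPa.cfc_nnreal _
  have hb : ∃ C : ℝ, ∀ x, ‖T.toLinearMap x‖ ≤ C * ‖B.toLinearMap x‖ :=
    ⟨1, fun x => by rw [one_mul]; exact (hnorm x).ge⟩
  set U : H →L[ℂ] H' := T.toLinearMap.extendOfNorm B.toLinearMap with hU
  have hUB : ∀ x, U (B x) = T x := fun x => LinearMap.extendOfNorm_eq hdense hb x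
  have hUnorm : ∀ x, ‖U x‖ = ‖x‖ := fun x => by
    refine hdense.induction_on x ?_ fun x => ?_
    · exact isClosed_eq U.continuous.norm continuous_norm
    · rw [hUB, hnorm]
  refine ⟨⟨U.toLinearMap, hUnorm⟩, fun a x => ?_⟩
  change U (σ a x) = τ a (U x)
  refine hdense.induction_on x ?_ fun x => ?_
  · exact isClosed_eq (U.continuous.comp (σ a).continuous) ((τ a).continuous.comp U.continuous)
  · have hc : σ a (B x) = B (σ a x) := congrArg (fun S : H →L[ℂ] H => S x) (hcomm a).eq.symm
    rw [hc, hUB, hUB, h]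

/-- If an intertwiner `S : H' → H` vanishes on the orthogonal complement of an invariant subspace
`M` and has injective adjoint, then the adjoint embeds `H` into `M`. -/
theorem Embeds.subrep_of_adjoint_injective {σ : A →⋆ₐ[ℂ] (H →L[ℂ] H)}
    {τ : A →⋆ₐ[ℂ] (H' →L[ℂ] H')} (N : Submodule ℂ H') (hN : ∀ (a : A), ∀ x ∈ Nᗮ, τ a x ∈ Nᗮ)
    (S : H' →L[ℂ] H) (hS : ∀ a x, S (τ a x) = σ a (S x)) (hSN : ∀ x ∈ N, S x = 0)
    (hinj : ∀ f : H, (∀ x, inner ℂ f (S x) = 0) → f = 0) :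
    Embeds σ (subrep τ Nᗮ hN) := by
  have hmem : ∀ f, S.adjoint f ∈ Nᗮ := fun f => by
    rw [Submodule.mem_orthogonal]
    intro x hx
    rw [ContinuousLinearMap.adjoint_inner_right, hSN x hx, inner_zero_left]
  have hint : ∀ a f, S.adjoint (σ a f) = τ a (S.adjoint f) := fun a f => by
    refine ext_inner_right ℂ fun x => ?_
    rw [ContinuousLinearMap.adjoint_inner_left, ← ContinuousLinearMap.adjoint_inner_right (τ a),
      ← ContinuousLinearMap.adjoint_inner_right (σ a), ← ContinuousLinearMap.star_eq_adjoint,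
      ← ContinuousLinearMap.star_eq_adjoint, ← map_star, ← map_star, ← hS,
      ContinuousLinearMap.adjoint_inner_left]
  refine Embeds.of_injective (S.adjoint.codRestrict Nᗮ hmem) ?_ fun a f => ?_
  · rw [injective_iff_map_eq_zero]
    intro f hf
    refine hinj f fun x => ?_
    have h0 : S.adjoint f = 0 := congrArg Subtype.val hf
    rw [← ContinuousLinearMap.adjoint_inner_left, h0, inner_zero_left]
  · exact Subtype.ext (hint a f)

/-- Intertwiners `S n : H' → H` that vanish on the orthogonal complement of an invariant subspace
`M` embed `H^{⊕ℕ}` into `M` as soon as each `S n` has total image already on a set `D n` on which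
all the other `S m` vanish. -/
theorem Embeds.countableSum_of_family {σ : A →⋆ₐ[ℂ] (H →L[ℂ] H)}
    {τ : A →⋆ₐ[ℂ] (H' →L[ℂ] H')} (N : Submodule ℂ H') (hN : ∀ (a : A), ∀ x ∈ Nᗮ, τ a x ∈ Nᗮ)
    (S : ℕ → H' →L[ℂ] H) (hS : ∀ n a x, S n (τ a x) = σ a (S n x))
    (hSN : ∀ n, ∀ x ∈ N, S n x = 0) (D : ℕ → Set H') (hD : ∀ m n, m ≠ n → ∀ x ∈ D n, S m x = 0)
    (htot : ∀ n (f : H), (∀ x ∈ D n, inner ℂ f (S n x) = 0) → f = 0) :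
    Embeds (countableSumRep σ) (subrep τ Nᗮ hN) := by
  obtain ⟨w, R, hw, hR⟩ := exists_countableSum_operator S
  refine Embeds.subrep_of_adjoint_injective N hN R (fun a x => ?_) (fun x hx => ?_) fun f hf => ?_
  · refine lp.ext (funext fun n => ?_)
    change R (τ a x) n = σ a (R x n)
    rw [hR, hR, hS, map_smul]
  · refine lp.ext (funext fun n => ?_)
    rw [hR, hSN n x hx, smul_zero, lp.coeFn_zero, Pi.zero_apply]
  · refine lp.ext (funext fun n => htot n _ fun x hx => ?_)
    have h0 := hf x
    rw [lp.inner_eq_tsum, tsum_eq_single n fun m hm => by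
      rw [hR, hD m n hm x hx, smul_zero, inner_zero_right], hR, inner_smul_right] at h0
    exact (mul_eq_zero.1 h0).resolve_left (hw n)

end Polar

/-! ### Walsh functions on product spaces -/

theorem lintegral_enorm_sq_eq {α : Type*} [MeasurableSpace α] {m : Measure α} (f : α → ℂ) :
    ∫⁻ x, ‖f x‖ₑ ^ 2 ∂m = eLpNorm f 2 m ^ 2 := by
  have h := eLpNorm_nnreal_pow_eq_lintegral (μ := m) (f := f) (p := 2) two_ne_zero
  simpa using h.symm

section Walsh

variable {ι K : Type*}

/-- The Walsh function `w ↦ ∏_{i ∈ T} ξ (w i)` on the product space `K^ι`. -/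
def walsh (ξ : K → ℝ) (T : Finset ι) (w : ι → K) : ℂ := ∏ i ∈ T, (ξ (w i) : ℂ)

theorem conj_walsh (ξ : K → ℝ) (T : Finset ι) (w : ι → K) :
    starRingEnd ℂ (walsh ξ T w) = walsh ξ T w := by
  rw [walsh, map_prod]
  exact Finset.prod_congr rfl fun i _ => Complex.conj_ofReal _

variable [MeasurableSpace K]

/-- A bounded real function on `(K, κ)` with mean `0`, variance `1` and absolute value bounded
below. -/
structure IsStandardized (ξ : K → ℝ) (κ : Measure K) : Prop where
  measurable : Measurable ξ
  bounded : ∃ M, ∀ k, |ξ k| ≤ M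
  integral_eq_zero : ∫ k, ξ k ∂κ = 0
  integral_sq : ∫ k, ξ k * ξ k ∂κ = 1
  sq_bounded_below : ∃ m, 0 < m ∧ ∀ k, m ≤ ξ k * ξ k

/-- On a non-trivial probability space the normalized centred indicator function of a set of
intermediate measure is standardized. -/
theorem exists_isStandardized {κ : Measure K} [IsProbabilityMeasure κ]
    (hκ : ∃ A : Set K, MeasurableSet A ∧ κ A ≠ 0 ∧ κ A ≠ 1) : ∃ ξ : K → ℝ, IsStandardized ξ κ := by
  obtain ⟨A, hA, h0, h1⟩ := hκ
  set p : ℝ := κ.real A with hp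
  have hp0 : 0 < p := by
    rw [hp, measureReal_def]
    exact ENNReal.toReal_pos h0 (measure_ne_top κ A)
  have hp1 : p < 1 := by
    rw [hp, measureReal_def]
    have : κ A < 1 := lt_of_le_of_ne prob_le_one h1
    simpa using (ENNReal.toReal_lt_toReal this.ne_top ENNReal.one_ne_top).2 this
  have hq : 0 < p * (1 - p) := mul_pos hp0 (by linarith)
  set s : ℝ := Real.sqrt (p * (1 - p)) with hs
  have hs0 : 0 < s := Real.sqrt_pos.2 hq
  have hss : s * s = p * (1 - p) := Real.mul_self_sqrt hq.le
  set i : K → ℝ := A.indicator (fun _ => 1) with hi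
  have him : Measurable i := measurable_const.indicator hA
  have hi01 : ∀ k, i k = 0 ∨ i k = 1 := fun k => by
    by_cases hk : k ∈ A
    · right; rw [hi, Set.indicator_of_mem hk]
    · left; rw [hi, Set.indicator_of_notMem hk]
  have hii : Integrable i κ := (integrable_const (1 : ℝ)).indicator hA
  have hint : ∫ k, i k ∂κ = p := by rw [hi, integral_indicator_const _ hA, smul_eq_mul, mul_one]
  refine ⟨fun k => (i k - p) / s, (him.sub_const p).div_const s, ⟨1 / s, fun k => ?_⟩, ?_, ?_,
    (min p (1 - p) / s) * (min p (1 - p) / s), ?_, fun k => ?_⟩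
  · rw [abs_div, abs_of_pos hs0]
    gcongr
    rcases hi01 k with h | h <;> rw [h, abs_le] <;> constructor <;> linarith
  · rw [integral_div, integral_sub hii (integrable_const _), hint, integral_const]
    simp
  · have : ∀ k, (i k - p) / s * ((i k - p) / s) = ((1 - 2 * p) * i k + p * p) / (p * (1 - p)) :=
      fun k => by
        rw [div_mul_div_comm, hss]
        congr 1
        rcases hi01 k with h | h <;> rw [h] <;> ring
    simp only [this]
    rw [integral_div, integral_add (hii.const_mul _) (integrable_const _), integral_const_mul,
      hint, integral_const]
    simp only [probReal_univ, one_smul]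
    rw [div_eq_one_iff_eq hq.ne']
    ring
  · have : 0 < min p (1 - p) := lt_min hp0 (by linarith)
    positivity
  · rw [div_mul_div_comm, div_mul_div_comm]
    gcongr ?_ / _
    have h1 := min_le_left p (1 - p)
    have h2 := min_le_right p (1 - p)
    have h3 : 0 < min p (1 - p) := lt_min hp0 (by linarith)
    rcases hi01 k with h | h <;> rw [h] <;> nlinarith

variable {κ : Measure K} {ξ : K → ℝ}

theorem IsStandardized.measurable_walsh (hξ : IsStandardized ξ κ) (T : Finset ι) :
    Measurable (walsh ξ T) :=
  Finset.measurable_fun_prod _ fun i _ =>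
    Complex.measurable_ofReal.comp (hξ.measurable.comp (measurable_pi_apply i))

theorem IsStandardized.exists_norm_walsh_le (hξ : IsStandardized ξ κ) (T : Finset ι) :
    ∃ C, ∀ w : ι → K, ‖walsh ξ T w‖ ≤ C := by
  obtain ⟨M, hM⟩ := hξ.bounded
  refine ⟨∏ i ∈ T, M, fun w => ?_⟩
  rw [walsh, norm_prod]
  refine Finset.prod_le_prod (fun i _ => norm_nonneg _) fun i _ => ?_
  rw [Complex.norm_real]
  exact hM _

variable [IsProbabilityMeasure κ]

theorem integral_infinitePi_prod (s : Finset ι) {η : ι → K → ℂ} (hη : ∀ i, Measurable (η i)) :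
    ∫ w, ∏ i ∈ s, η i (w i) ∂(Measure.infinitePi fun _ : ι => κ) = ∏ i ∈ s, ∫ k, η i k ∂κ := by
  have h : ∀ w : ι → K, ∏ i ∈ s, η i (w i) = ∏ i : s, η i (s.restrict w i) := fun w =>
    (Finset.prod_coe_sort s fun i => η i (w i)).symm
  simp only [h]
  have hm : Measurable fun v : s → K => ∏ i : s, η i (v i) :=
    Finset.measurable_fun_prod _ fun i _ => (hη i).comp (measurable_pi_apply i)
  refine (integral_restrict_infinitePi (μ := fun _ : ι => κ) hm.aestronglyMeasurable).trans ?_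
  rw [integral_fintype_prod_eq_prod (fun (i : s) k => η i k),
    Finset.prod_coe_sort s fun i => ∫ k, η i k ∂κ]

namespace IsStandardized

theorem memLp_walsh (hξ : IsStandardized ξ κ) (T : Finset ι) :
    MemLp (walsh ξ T) 2 (Measure.infinitePi fun _ : ι => κ) := by
  obtain ⟨C, hC⟩ := hξ.exists_norm_walsh_le T
  exact MemLp.of_bound (hξ.measurable_walsh T).aestronglyMeasurable C (ae_of_all _ hC)

/-- The Walsh functions are orthonormal. -/
theorem integral_walsh_mul_walsh [DecidableEq ι] (hξ : IsStandardized ξ κ) (T T' : Finset ι) :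
    ∫ w, walsh ξ T w * walsh ξ T' w ∂(Measure.infinitePi fun _ : ι => κ) =
      if T = T' then 1 else 0 := by
  set η : ι → K → ℂ := fun i k =>
    (if i ∈ T then (ξ k : ℂ) else 1) * (if i ∈ T' then (ξ k : ℂ) else 1) with hηdef
  have hcoe : Measurable fun k => (ξ k : ℂ) := Complex.measurable_ofReal.comp hξ.measurable
  have hη : ∀ i, Measurable (η i) := fun i => by
    refine Measurable.mul ?_ ?_ <;> split_ifs <;> first | exact hcoe | exact measurable_const
  have hprod : ∀ w : ι → K, walsh ξ T w * walsh ξ T' w = ∏ i ∈ T ∪ T', η i (w i) := fun w => by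
    rw [Finset.prod_mul_distrib, walsh, walsh]
    congr 1
    · rw [← Finset.prod_subset (Finset.subset_union_left (s₁ := T) (s₂ := T'))]
      · exact Finset.prod_congr rfl fun i hi => (if_pos hi).symm
      · intro i _ hi; exact if_neg hi
    · rw [← Finset.prod_subset (Finset.subset_union_right (s₁ := T) (s₂ := T'))]
      · exact Finset.prod_congr rfl fun i hi => (if_pos hi).symm
      · intro i _ hi; exact if_neg hi
  have h1 : ∫ k, (ξ k : ℂ) ∂κ = 0 := by rw [integral_complex_ofReal, hξ.integral_eq_zero]; simp
  have h2 : ∫ k, (ξ k : ℂ) * (ξ k : ℂ) ∂κ = 1 := by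
    have := hξ.integral_sq
    simp only [← Complex.ofReal_mul]
    rw [integral_complex_ofReal, this, Complex.ofReal_one]
  simp only [hprod]
  rw [integral_infinitePi_prod _ hη]
  split_ifs with hT
  · subst hT
    refine Finset.prod_eq_one fun i hi => ?_
    have hi' : i ∈ T := by simpa using hi
    simp only [hηdef, if_pos hi', h2]
  · obtain ⟨i, hi⟩ : ∃ i, ¬(i ∈ T ↔ i ∈ T') := by
      by_contra hcon
      push Not at hcon
      exact hT (Finset.ext hcon)
    have hmem : i ∈ T ∪ T' := by rw [Finset.mem_union]; tauto
    refine Finset.prod_eq_zero hmem ?_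
    by_cases hiT : i ∈ T
    · have hiT' : i ∉ T' := by tauto
      simp only [hηdef, if_pos hiT, if_neg hiT', mul_one, h1]
    · have hiT' : i ∈ T' := by tauto
      simp only [hηdef, if_pos hiT', if_neg hiT, one_mul, h1]

/-- **Bessel's inequality** for the Walsh functions. -/
theorem tsum_sq_integral_mul_walsh_le (hξ : IsStandardized ξ κ) {f : (ι → K) → ℂ}
    (hf : MemLp f 2 (Measure.infinitePi fun _ : ι => κ)) :
    ∑' T : Finset ι, ‖∫ w, f w * walsh ξ T w ∂(Measure.infinitePi fun _ : ι => κ)‖ₑ ^ 2 ≤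
      ∫⁻ w, ‖f w‖ₑ ^ 2 ∂(Measure.infinitePi fun _ : ι => κ) := by
  classical
  set m := Measure.infinitePi fun _ : ι => κ
  set e : Finset ι → Lp ℂ 2 m := fun T => (hξ.memLp_walsh T).toLp (walsh ξ T) with he
  have hin : ∀ {g g' : (ι → K) → ℂ} (hg : MemLp g 2 m) (hg' : MemLp g' 2 m),
      inner ℂ (hg.toLp g) (hg'.toLp g') = ∫ w, g' w * starRingEnd ℂ (g w) ∂m := by
    intro g g' hg hg'
    rw [L2.inner_def]
    apply integral_congr_ae
    filter_upwards [hg.coeFn_toLp, hg'.coeFn_toLp] with w h1 h2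
    rw [h1, h2, RCLike.inner_apply]
  have hon : Orthonormal ℂ e := by
    rw [orthonormal_iff_ite]
    intro T T'
    rw [he, hin]
    simp only [conj_walsh]
    rw [hξ.integral_walsh_mul_walsh]
    simp only [eq_comm]
  have hcoef : ∀ T, inner ℂ (e T) (hf.toLp f) = ∫ w, f w * walsh ξ T w ∂m := fun T => by
    rw [he, hin]
    simp only [conj_walsh]
  have hnorm : ENNReal.ofReal (‖hf.toLp f‖ ^ 2) = ∫⁻ w, ‖f w‖ₑ ^ 2 ∂m := by
    rw [ENNReal.ofReal_pow (norm_nonneg _), ofReal_norm, Lp.enorm_toLp, lintegral_enorm_sq_eq]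
  rw [← hnorm, ENNReal.tsum_eq_iSup_sum]
  refine iSup_le fun s => ?_
  calc ∑ T ∈ s, ‖∫ w, f w * walsh ξ T w ∂m‖ₑ ^ 2
      = ENNReal.ofReal (∑ T ∈ s, ‖inner ℂ (e T) (hf.toLp f)‖ ^ 2) := by
        rw [ENNReal.ofReal_sum_of_nonneg fun _ _ => by positivity]
        refine Finset.sum_congr rfl fun T _ => ?_
        rw [hcoef, ENNReal.ofReal_pow (norm_nonneg _), ofReal_norm]
    _ ≤ ENNReal.ofReal (‖hf.toLp f‖ ^ 2) :=
        ENNReal.ofReal_le_ofReal (hon.sum_inner_products_le _)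

end IsStandardized

end Walsh

/-! ### Patterns of cosets -/

section Patterns

variable {G : Type*} [Group G] {Γ : Subgroup G}

/-- Right translation `Γ h ↦ Γ h p` on the set of right cosets. -/
def cosetMul (c : RightCosets Γ) (p : G) : RightCosets Γ :=
  Quotient.map (fun h => h * p) (fun h k hk => by
    change QuotientGroup.rightRel _ _ _ at hk
    change QuotientGroup.rightRel _ _ _
    rw [QuotientGroup.rightRel_apply] at hk ⊢
    simpa [mul_assoc] using hk) c

theorem cosetMul_rightCoset (h p : G) :
    cosetMul (rightCoset Γ h) p = rightCoset Γ (h * p) := rfl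

theorem cosetMul_one (c : RightCosets Γ) : cosetMul c 1 = c := by
  induction c using Quotient.inductionOn with
  | h h => exact congrArg (rightCoset Γ) (mul_one h)

open Classical in
/-- The finite set `c P` of cosets, for a coset `c` and a finite subset `P` of `G`. -/
def pattern (c : RightCosets Γ) (P : Finset G) : Finset (RightCosets Γ) := P.image (cosetMul c)

/-- `P` is a set of `n + 1` elements which contains `1` and on which `p ↦ c p` is injective; so
`c P` is a set of `n + 1` cosets containing `c`. -/
def IsPattern (n : ℕ) (c : RightCosets Γ) (P : Finset G) : Prop :=
  1 ∈ P ∧ P.card = n + 1 ∧ (pattern c P).card = n + 1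

theorem IsPattern.mem {n : ℕ} {c : RightCosets Γ} {P : Finset G} (h : IsPattern n c P) :
    c ∈ pattern c P := by
  classical
  exact Finset.mem_image.2 ⟨1, h.1, cosetMul_one c⟩

theorem card_pattern_eq_iff {c : RightCosets Γ} {P : Finset G} :
    (pattern c P).card = P.card ↔ Set.InjOn (cosetMul c) P := by
  classical
  exact Finset.card_image_iff

/-- Every set of `n + 1` cosets is of the form `c P`, for any of its elements `c`. -/
theorem exists_isPattern {n : ℕ} {T : Finset (RightCosets Γ)} (hT : T.card = n + 1)
    {c : RightCosets Γ} (hc : c ∈ T) : ∃ P, IsPattern n c P ∧ pattern c P = T := by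
  classical
  obtain ⟨h, rfl⟩ := Quotient.exists_rep c
  change rightCoset Γ h ∈ T at hc
  have hr : ∀ d : RightCosets Γ, ∃ p : G, rightCoset Γ (h * p) = d ∧
      (d = rightCoset Γ h → p = 1) := fun d => by
    by_cases hd : d = rightCoset Γ h
    · exact ⟨1, by rw [mul_one, hd], fun _ => rfl⟩
    · obtain ⟨k, rfl⟩ := Quotient.exists_rep d
      exact ⟨h⁻¹ * k, by rw [mul_inv_cancel_left], fun h' => absurd h' hd⟩
  choose r hr1 hr2 using hr
  have hinj : Function.Injective r := fun d d' hdd => by rw [← hr1 d, ← hr1 d', hdd]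
  have hpat : pattern (rightCoset Γ h) (T.image r) = T := by
    rw [pattern, Finset.image_image]
    have : cosetMul (rightCoset Γ h) ∘ r = id := funext fun d => hr1 d
    rw [this, Finset.image_id]
  refine ⟨T.image r, ⟨?_, ?_, ?_⟩, hpat⟩
  · exact Finset.mem_image.2 ⟨_, hc, hr2 _ rfl⟩
  · rw [Finset.card_image_of_injective _ hinj, hT]
  · change (pattern (rightCoset Γ h) (T.image r)).card = n + 1
    rw [hpat, hT]

theorem cosetSMul_cosetMul (g : G) {Δ : Subgroup G} (hΔ : Δ = g • Γ) (c : RightCosets Γ) (p : G) :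
    cosetSMul g hΔ (cosetMul c p) = cosetMul (cosetSMul g hΔ c) p := by
  induction c using Quotient.inductionOn with
  | h h =>
    change cosetSMul g hΔ (rightCoset Γ (h * p)) = rightCoset Δ (g * h * p)
    rw [cosetSMul_rightCoset, mul_assoc]

theorem pattern_cosetSMul (g : G) {Δ : Subgroup G} (hΔ : Δ = g • Γ) (c : RightCosets Γ)
    (P : Finset G) :
    pattern (cosetSMul g hΔ c) P = (pattern c P).map (cosetSMul g hΔ).toEmbedding := by
  classical
  rw [pattern, pattern, Finset.map_eq_image, Finset.image_image]
  refine congrArg (fun f => P.image f) (funext fun p => ?_)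
  exact (cosetSMul_cosetMul g hΔ c p).symm

theorem isPattern_cosetSMul (g : G) {Δ : Subgroup G} (hΔ : Δ = g • Γ) {n : ℕ} (c : RightCosets Γ)
    (P : Finset G) : IsPattern n (cosetSMul g hΔ c) P ↔ IsPattern n c P := by
  rw [IsPattern, IsPattern, pattern_cosetSMul, Finset.card_map]

theorem measurableSet_card_pattern (h : G) (P : Finset G) :
    MeasurableSet {Γ : Subgroup G | (pattern (rightCoset Γ h) P).card = P.card} := by
  have : {Γ : Subgroup G | (pattern (rightCoset Γ h) P).card = P.card} =
      ⋂ p ∈ P, ⋂ q ∈ P, ⋂ (_ : p ≠ q), {Γ : Subgroup G | h * q * (h * p)⁻¹ ∈ Γ}ᶜ := by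
    ext Γ
    simp only [Set.mem_ofPred_eq, card_pattern_eq_iff, Set.mem_iInter, Set.mem_compl_iff,
      ← rightCoset_eq_iff]
    constructor
    · intro hinj p hp q hq hpq heq
      exact hpq (hinj hp hq heq)
    · intro hall p hp q hq heq
      by_contra hpq
      exact hall p hp q hq hpq heq
  rw [this]
  exact Finset.measurableSet_biInter _ fun p _ => Finset.measurableSet_biInter _ fun q _ =>
    MeasurableSet.iInter fun _ => (measurableSet_mem _).compl

theorem measurableSet_isPattern (n : ℕ) (h : G) (P : Finset G) :
    MeasurableSet {Γ : Subgroup G | IsPattern n (rightCoset Γ h) P} := by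
  by_cases hP : 1 ∈ P ∧ P.card = n + 1
  · have : {Γ : Subgroup G | IsPattern n (rightCoset Γ h) P} =
        {Γ : Subgroup G | (pattern (rightCoset Γ h) P).card = P.card} := by
      ext Γ
      simp only [Set.mem_ofPred_eq, IsPattern, hP, true_and]
    rw [this]
    exact measurableSet_card_pattern h P
  · have : {Γ : Subgroup G | IsPattern n (rightCoset Γ h) P} = ∅ := by
      ext Γ
      simp only [Set.mem_ofPred_eq, Set.mem_empty_iff_false, iff_false]
      exact fun hp => hP ⟨hp.1, hp.2.1⟩
    rw [this]
    exact MeasurableSet.empty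

theorem walsh_pattern {K : Type*} {ξ : K → ℝ} {h : G} {P : Finset G} (hP : (pattern (rightCoset Γ h) P).card = P.card)
    (w : RightCosets Γ → K) :
    walsh ξ (pattern (rightCoset Γ h) P) w = ∏ p ∈ P, (ξ (ofCosets Γ w (h * p)) : ℂ) := by
  classical
  exact Finset.prod_image (card_pattern_eq_iff.1 hP)

end Patterns

/-! ### Walsh coefficients on Bernoulli spaces -/

section Coefficients

theorem sq_tsum_mul_le {ι : Type*} (u b : ι → ℝ≥0∞) :
    (∑' i, u i * b i) ^ 2 ≤ 2 * (∑' i, u i) * ∑' i, u i * b i ^ 2 := by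
  have h : ∀ x y : ℝ≥0∞, x * y ≤ x ^ 2 + y ^ 2 := fun x y => by
    rcases le_total x y with hxy | hxy
    · exact (mul_le_mul_left hxy y).trans ((sq y).symm.le.trans le_add_self)
    · exact (mul_le_mul_right hxy x).trans ((sq x).symm.le.trans le_self_add)
  calc (∑' i, u i * b i) ^ 2 = ∑' i, ∑' j, (u i * b i) * (u j * b j) := by
        rw [sq, ← ENNReal.tsum_mul_right]
        exact tsum_congr fun i => ENNReal.tsum_mul_left.symm
    _ ≤ ∑' i, ∑' j, (u i * b i ^ 2 * u j + u i * (u j * b j ^ 2)) := by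
        refine ENNReal.tsum_le_tsum fun i => ENNReal.tsum_le_tsum fun j => ?_
        calc u i * b i * (u j * b j) = u i * u j * (b i * b j) := by ring
          _ ≤ u i * u j * (b i ^ 2 + b j ^ 2) := by gcongr; exact h _ _
          _ = _ := by ring
    _ = 2 * (∑' i, u i) * ∑' i, u i * b i ^ 2 := by
        simp only [ENNReal.tsum_add, ENNReal.tsum_mul_left, ENNReal.tsum_mul_right]
        ring

variable {G K : Type*} [Group G] [MeasurableSpace K] (ξ : K → ℝ) (κ : Measure K)

/-- The coefficient of a function `F` on `(K^G, κ^{Γ\G})` with respect to the Walsh function of the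
set `T` of cosets. -/
def walshCoeff (F : ShiftSpace G K → ℂ) {Γ : Subgroup G} (T : Finset (RightCosets Γ)) : ℂ :=
  ∫ w, F (ofCosets Γ w) * walsh ξ T w ∂(Measure.infinitePi fun _ : RightCosets Γ => κ)

open Classical in
/-- The scalar product of `F` with the vector
`v_n(c) = ∑_P u_P · (Walsh function of c P)`, where `P` runs over the finite sets with
`IsPattern n c P`.  The family `v_n` is equivariant in `c`, and `v_n(c)` is a combination with
positive coefficients of all the Walsh functions of sets of `n + 1` cosets containing `c`. -/
def patternCoeff (u : Finset G → NNReal) (n : ℕ) (F : ShiftSpace G K → ℂ) {Γ : Subgroup G}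
    (c : RightCosets Γ) : ℂ :=
  ∑' P : Finset G, if IsPattern n c P then (u P : ℂ) * walshCoeff ξ κ F (pattern c P) else 0

variable {ξ κ} {Γ : Subgroup G} {u : Finset G → NNReal}

theorem memLp_comp_ofCosets {F : ShiftSpace G K → ℂ} (hF : MemLp F 2 (bernoulli κ Γ)) :
    MemLp (fun w => F (ofCosets Γ w)) 2 (Measure.infinitePi fun _ : RightCosets Γ => κ) :=
  (memLp_map_measure_iff hF.1 (measurable_ofCosets Γ).aemeasurable).1 hF

theorem patternCoeff_const_mul (n : ℕ) (r : ℂ) (F : ShiftSpace G K → ℂ) (c : RightCosets Γ) :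
    patternCoeff ξ κ u n (fun x => r * F x) c = r * patternCoeff ξ κ u n F c := by
  classical
  rw [patternCoeff, patternCoeff, ← tsum_mul_left]
  refine tsum_congr fun P => ?_
  split_ifs
  · rw [walshCoeff, walshCoeff, mul_left_comm]
    congr 1
    rw [← integral_const_mul]
    simp only [mul_assoc]
  · rw [mul_zero]

theorem patternCoeff_congr (n : ℕ) {F F' : ShiftSpace G K → ℂ} (h : F =ᵐ[bernoulli κ Γ] F')
    (c : RightCosets Γ) : patternCoeff ξ κ u n F c = patternCoeff ξ κ u n F' c := by
  classical
  have hw : ∀ᵐ w ∂(Measure.infinitePi fun _ : RightCosets Γ => κ),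
      F (ofCosets Γ w) = F' (ofCosets Γ w) :=
    ae_of_ae_map (measurable_ofCosets Γ).aemeasurable h
  refine tsum_congr fun P => ?_
  split_ifs
  · congr 1
    refine integral_congr_ae ?_
    filter_upwards [hw] with w h1
    rw [h1]
  · rfl

variable [IsProbabilityMeasure κ]

theorem tsum_sq_walshCoeff_le (hξ : IsStandardized ξ κ) {F : ShiftSpace G K → ℂ}
    (hF : MemLp F 2 (bernoulli κ Γ)) :
    ∑' T : Finset (RightCosets Γ), ‖walshCoeff ξ κ F T‖ₑ ^ 2 ≤
      ∫⁻ x, ‖F x‖ₑ ^ 2 ∂(bernoulli κ Γ) := by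
  refine (hξ.tsum_sq_integral_mul_walsh_le (memLp_comp_ofCosets hF)).trans_eq ?_
  exact (lintegral_map' (f := fun x => ‖F x‖ₑ ^ 2) (hF.1.enorm.pow_const 2)
    (measurable_ofCosets Γ).aemeasurable).symm

/-- The bound behind the boundedness of `F ↦ (patternCoeff F c)_c`: a set of `n + 1` cosets is of
the form `c P` for at most `n + 1` cosets `c`. -/
theorem tsum_sq_patternCoeff_le (hξ : IsStandardized ξ κ) (hu : ∑' P, (u P : ℝ≥0∞) ≤ 1) (n : ℕ)
    {F : ShiftSpace G K → ℂ} (hF : MemLp F 2 (bernoulli κ Γ)) :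
    ∑' c : RightCosets Γ, ‖patternCoeff ξ κ u n F c‖ₑ ^ 2 ≤
      2 * (n + 1) * ∫⁻ x, ‖F x‖ₑ ^ 2 ∂(bernoulli κ Γ) := by
  classical
  set a : Finset (RightCosets Γ) → ℝ≥0∞ := fun T => ‖walshCoeff ξ κ F T‖ₑ with ha
  set b : RightCosets Γ → Finset G → ℝ≥0∞ :=
    fun c P => if IsPattern n c P then a (pattern c P) else 0 with hb
  have h1 : ∀ c, ‖patternCoeff ξ κ u n F c‖ₑ ^ 2 ≤ 2 * ∑' P, (u P : ℝ≥0∞) * b c P ^ 2 := fun c =>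
    calc ‖patternCoeff ξ κ u n F c‖ₑ ^ 2 ≤ (∑' P, (u P : ℝ≥0∞) * b c P) ^ 2 := by
          gcongr
          refine enorm_tsum_le_tsum_enorm.trans_eq (tsum_congr fun P => ?_)
          by_cases hP : IsPattern n c P
          · simp only [hb, if_pos hP, enorm_mul, ha]
            congr 1
            rw [← ofReal_norm, Complex.norm_real, Real.norm_of_nonneg (u P).coe_nonneg,
              ENNReal.ofReal_coe_nnreal]
          · simp only [hb, if_neg hP, enorm_zero, mul_zero]
      _ ≤ 2 * (∑' P, (u P : ℝ≥0∞)) * ∑' P, (u P : ℝ≥0∞) * b c P ^ 2 := sq_tsum_mul_le _ _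
      _ ≤ 2 * 1 * ∑' P, (u P : ℝ≥0∞) * b c P ^ 2 := by gcongr
      _ = _ := by rw [mul_one]
  have h2 : ∀ P, ∑' c, b c P ^ 2 ≤ (n + 1) * ∑' T, a T ^ 2 := fun P =>
    calc ∑' c, b c P ^ 2 ≤ ∑' c, ∑' T : Finset (RightCosets Γ),
            if c ∈ T ∧ T.card = n + 1 then a T ^ 2 else 0 := by
          refine ENNReal.tsum_le_tsum fun c => ?_
          by_cases hP : IsPattern n c P
          · refine le_trans ?_ (ENNReal.le_tsum (pattern c P))
            rw [if_pos ⟨hP.mem, hP.2.2⟩]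
            simp only [hb, if_pos hP, le_refl]
          · simp [hb, hP]
      _ = ∑' T : Finset (RightCosets Γ), ∑' c, if c ∈ T ∧ T.card = n + 1 then a T ^ 2 else 0 :=
          ENNReal.tsum_comm
      _ ≤ ∑' T, (n + 1) * a T ^ 2 := by
          refine ENNReal.tsum_le_tsum fun T => ?_
          by_cases hT : T.card = n + 1
          · simp only [hT, and_true]
            rw [tsum_eq_sum (s := T) fun c hc => if_neg hc, Finset.sum_ite_mem, Finset.inter_self,
              Finset.sum_const, hT, nsmul_eq_mul]
            push_cast
            rfl
          · simp [hT]
      _ = _ := ENNReal.tsum_mul_left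
  calc ∑' c, ‖patternCoeff ξ κ u n F c‖ₑ ^ 2 ≤ ∑' c, 2 * ∑' P, (u P : ℝ≥0∞) * b c P ^ 2 :=
        ENNReal.tsum_le_tsum h1
    _ = 2 * ∑' P, (u P : ℝ≥0∞) * ∑' c, b c P ^ 2 := by
        rw [ENNReal.tsum_mul_left, ENNReal.tsum_comm]
        simp only [ENNReal.tsum_mul_left]
    _ ≤ 2 * ∑' P, (u P : ℝ≥0∞) * ((n + 1) * ∑' T, a T ^ 2) := by
        gcongr with P
        exact h2 P
    _ ≤ 2 * (1 * ((n + 1) * ∑' T, a T ^ 2)) := by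
        rw [ENNReal.tsum_mul_right]
        gcongr
    _ ≤ 2 * (n + 1) * ∫⁻ x, ‖F x‖ₑ ^ 2 ∂(bernoulli κ Γ) := by
        rw [one_mul, ← mul_assoc]
        gcongr
        exact tsum_sq_walshCoeff_le hξ hF

theorem integrable_mul_walsh (hξ : IsStandardized ξ κ) {F : ShiftSpace G K → ℂ}
    (hF : MemLp F 2 (bernoulli κ Γ)) (T : Finset (RightCosets Γ)) :
    Integrable (fun w => F (ofCosets Γ w) * walsh ξ T w)
      (Measure.infinitePi fun _ : RightCosets Γ => κ) :=
  (memLp_comp_ofCosets hF).integrable_mul (hξ.memLp_walsh T)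

theorem summable_patternCoeff (hξ : IsStandardized ξ κ) (hu : ∑' P, (u P : ℝ≥0∞) ≤ 1) (n : ℕ)
    {F : ShiftSpace G K → ℂ} (hF : MemLp F 2 (bernoulli κ Γ)) (c : RightCosets Γ)
    [∀ P, Decidable (IsPattern n c P)] :
    Summable fun P : Finset G =>
      if IsPattern n c P then (u P : ℂ) * walshCoeff ξ κ F (pattern c P) else 0 := by
  have hfin : ∫⁻ x, ‖F x‖ₑ ^ 2 ∂(bernoulli κ Γ) < ∞ := by
    rw [lintegral_enorm_sq_eq]
    exact ENNReal.pow_lt_top hF.2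
  set C : ℝ := Real.sqrt (∫⁻ x, ‖F x‖ₑ ^ 2 ∂(bernoulli κ Γ)).toReal
  have hC : ∀ T : Finset (RightCosets Γ), ‖walshCoeff ξ κ F T‖ ≤ C := fun T => by
    refine Real.le_sqrt_of_sq_le ?_
    have h := (ENNReal.le_tsum T).trans (tsum_sq_walshCoeff_le hξ hF)
    have h' := ENNReal.toReal_mono hfin.ne h
    rwa [ENNReal.toReal_pow, toReal_enorm] at h'
  have hsu : Summable fun P => (u P : ℝ) := by
    rw [NNReal.summable_coe]
    exact ENNReal.tsum_coe_ne_top_iff_summable.1 (ne_top_of_le_ne_top ENNReal.one_ne_top hu)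
  refine Summable.of_norm_bounded (hsu.mul_right C) fun P => ?_
  split_ifs with hP
  · rw [norm_mul, Complex.norm_real, Real.norm_of_nonneg (u P).coe_nonneg]
    gcongr
    exact hC _
  · rw [norm_zero]
    exact mul_nonneg (u P).coe_nonneg (Real.sqrt_nonneg _)

theorem patternCoeff_add (hξ : IsStandardized ξ κ) (hu : ∑' P, (u P : ℝ≥0∞) ≤ 1) (n : ℕ)
    {F F' : ShiftSpace G K → ℂ} (hF : MemLp F 2 (bernoulli κ Γ))
    (hF' : MemLp F' 2 (bernoulli κ Γ)) (c : RightCosets Γ) :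
    patternCoeff ξ κ u n (fun x => F x + F' x) c =
      patternCoeff ξ κ u n F c + patternCoeff ξ κ u n F' c := by
  classical
  rw [patternCoeff, patternCoeff, patternCoeff,
    ← (summable_patternCoeff hξ hu n hF c).tsum_add (summable_patternCoeff hξ hu n hF' c)]
  refine tsum_congr fun P => ?_
  split_ifs
  · rw [← mul_add]
    congr 1
    rw [walshCoeff, walshCoeff, walshCoeff,
      ← integral_add (integrable_mul_walsh hξ hF _) (integrable_mul_walsh hξ hF' _)]
    simp only [add_mul]
  · rw [add_zero]

/-- The vectors `v_n(c)` are orthogonal to the constants. -/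
theorem patternCoeff_const (hξ : IsStandardized ξ κ) (n : ℕ) (r : ℂ) (c : RightCosets Γ) :
    patternCoeff ξ κ u n (fun _ => r) c = 0 := by
  classical
  refine (tsum_congr fun P => ?_).trans tsum_zero
  split_ifs with hP
  · have h := hξ.integral_walsh_mul_walsh (∅ : Finset (RightCosets Γ)) (pattern c P)
    rw [if_neg (Finset.ne_empty_of_mem hP.mem).symm] at h
    simp only [walsh, Finset.prod_empty, one_mul] at h
    rw [walshCoeff, integral_const_mul]
    simp only [walsh]
    rw [h, mul_zero, mul_zero]
  · rfl

/-- The scalar product of `v_n(c)` with the Walsh function of a set `T` of cosets vanishes unless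
`T` has `n + 1` elements and contains `c`, when it is positive. -/
theorem exists_patternCoeff_walsh (hξ : IsStandardized ξ κ) (hu0 : ∀ P, 0 < u P)
    (hu : ∑' P, (u P : ℝ≥0∞) ≤ 1) (n : ℕ) {F : ShiftSpace G K → ℂ} (T : Finset (RightCosets Γ))
    (hF : ∀ w, F (ofCosets Γ w) = walsh ξ T w) (c : RightCosets Γ) :
    ∃ t : ℝ, patternCoeff ξ κ u n F c = t ∧ (c ∈ T → T.card = n + 1 → 0 < t) ∧
      (c ∉ T ∨ T.card ≠ n + 1 → t = 0) := by
  classical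
  set t : Finset G → ℝ := fun P => if IsPattern n c P ∧ pattern c P = T then (u P : ℝ) else 0
    with ht
  have hsu : Summable fun P => (u P : ℝ) := by
    rw [NNReal.summable_coe]
    exact ENNReal.tsum_coe_ne_top_iff_summable.1 (ne_top_of_le_ne_top ENNReal.one_ne_top hu)
  have ht0 : ∀ P, 0 ≤ t P := fun P => by
    simp only [ht]; split_ifs
    · exact (u P).coe_nonneg
    · exact le_rfl
  have hst : Summable t := hsu.of_nonneg_of_le ht0 fun P => by
    simp only [ht]; split_ifs
    · exact le_rfl
    · exact (u P).coe_nonneg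
  refine ⟨∑' P, t P, ?_, fun hc hT => ?_, fun h => ?_⟩
  · rw [patternCoeff, Complex.ofReal_tsum]
    refine tsum_congr fun P => ?_
    have hw : walshCoeff ξ κ F (pattern c P) = if pattern c P = T then 1 else 0 := by
      rw [walshCoeff]
      simp only [hF]
      rw [hξ.integral_walsh_mul_walsh]
      simp only [eq_comm]
    simp only [ht, hw]
    by_cases h1 : IsPattern n c P <;> by_cases h2 : pattern c P = T <;> simp [h1, h2]
  · obtain ⟨P, hP, hPT⟩ := exists_isPattern hT hc
    refine hst.tsum_pos ht0 P ?_
    simp only [ht, hP, hPT, and_self, if_true]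
    exact_mod_cast hu0 P
  · refine (tsum_congr fun P => ?_).trans tsum_zero
    refine if_neg ?_
    rintro ⟨hP, rfl⟩
    rcases h with h | h
    · exact h hP.mem
    · exact h hP.2.2

theorem walshCoeff_smul (g : G) {Δ : Subgroup G} (hΔ : Δ = g • Γ) (F : ShiftSpace G K → ℂ)
    (T : Finset (RightCosets Γ)) :
    walshCoeff ξ κ (fun x => F (g • x)) T =
      walshCoeff ξ κ F (T.map (cosetSMul g hΔ).toEmbedding) := by
  set e := cosetSMul g hΔ
  let E : (RightCosets Δ → K) ≃ᵐ (RightCosets Γ → K) :=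
    { toEquiv := Equiv.arrowCongr e.symm (Equiv.refl K)
      measurable_toFun := measurable_pi_lambda _ fun i => measurable_pi_apply _
      measurable_invFun := measurable_pi_lambda _ fun i => measurable_pi_apply _ }
  have hE : (Measure.infinitePi fun _ : RightCosets Δ => κ).map E =
      Measure.infinitePi fun _ : RightCosets Γ => κ := map_infinitePi_reindex κ e.injective
  rw [walshCoeff, walshCoeff, ← hE, integral_map_equiv]
  refine integral_congr_ae (ae_of_all _ fun w => ?_)
  have h1 : g • ofCosets Γ (E w) = ofCosets Δ w := funext fun t => by
    change w (e (rightCoset Γ (g⁻¹ * t))) = w (rightCoset Δ t)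
    rw [cosetSMul_rightCoset, mul_inv_cancel_left]
  have h2 : walsh ξ (T.map e.toEmbedding) w = walsh ξ T (E w) := Finset.prod_map _ _ _
  simp only [h1, h2]

theorem patternCoeff_smul (g : G) {Δ : Subgroup G} (hΔ : Δ = g • Γ) (n : ℕ)
    (F : ShiftSpace G K → ℂ) (c : RightCosets Γ) :
    patternCoeff ξ κ u n (fun x => F (g • x)) c =
      patternCoeff ξ κ u n F (cosetSMul g hΔ c) := by
  classical
  refine tsum_congr fun P => ?_
  simp only [isPattern_cosetSMul, pattern_cosetSMul, walshCoeff_smul g hΔ]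

variable {Y Z : Type*} [MeasurableSpace Y] [MeasurableSpace Z]

theorem measurable_patternCoeff [Countable G] (hξ : IsStandardized ξ κ) (n : ℕ)
    {Γ : Z → Subgroup G} (hΓ : Measurable Γ) {π : Z → Y} (hπ : Measurable π)
    {F : ShiftSpace G K × Y → ℂ} (hF : Measurable F) (h : G) :
    Measurable fun z => patternCoeff ξ κ u n (fun x => F (x, π z)) (rightCoset (Γ z) h) := by
  classical
  let k : ProbabilityTheory.Kernel Z (ShiftSpace G K) :=
    ⟨fun z => bernoulli κ (Γ z), (measurable_bernoulli κ).comp hΓ⟩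
  have : ProbabilityTheory.IsMarkovKernel k :=
    ⟨fun z => inferInstanceAs (IsProbabilityMeasure (bernoulli κ (Γ z)))⟩
  refine Measurable.tsum fun P => ?_
  have hW : Measurable fun x : ShiftSpace G K => ∏ p ∈ P, (ξ (x (h * p)) : ℂ) :=
    Finset.measurable_fun_prod _ fun p _ => Complex.measurable_ofReal.comp
      (hξ.measurable.comp (measurable_pi_apply (X := fun _ : G => K) (h * p)))
  have hI : Measurable fun z => ∫ x, F (x, π z) * ∏ p ∈ P, (ξ (x (h * p)) : ℂ) ∂(k z) := by
    refine (StronglyMeasurable.integral_kernel_prod_right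
      (f := fun z x => F (x, π z) * ∏ p ∈ P, (ξ (x (h * p)) : ℂ)) ?_).measurable
    refine Measurable.stronglyMeasurable ?_
    exact (hF.comp (measurable_snd.prodMk (hπ.comp measurable_fst))).mul (hW.comp measurable_snd)
  have heq : (fun z => if IsPattern n (rightCoset (Γ z) h) P then
      (u P : ℂ) * walshCoeff ξ κ (fun x => F (x, π z)) (pattern (rightCoset (Γ z) h) P) else 0) =
      fun z => if IsPattern n (rightCoset (Γ z) h) P then
      (u P : ℂ) * ∫ x, F (x, π z) * ∏ p ∈ P, (ξ (x (h * p)) : ℂ) ∂(k z) else 0 := by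
    funext z
    split_ifs with hP
    · congr 1
      have hm : Measurable fun x : ShiftSpace G K => F (x, π z) * ∏ p ∈ P, (ξ (x (h * p)) : ℂ) :=
        (hF.comp measurable_prodMk_right).mul hW
      change _ = ∫ x, F (x, π z) * ∏ p ∈ P, (ξ (x (h * p)) : ℂ) ∂(bernoulli κ (Γ z))
      rw [bernoulli, integral_map (measurable_ofCosets _).aemeasurable hm.aestronglyMeasurable,
        walshCoeff]
      simp only [walsh_pattern (hP.2.2.trans hP.2.1.symm)]
    · rfl
  rw [heq]
  exact Measurable.ite (hΓ (measurableSet_isPattern n h P)) (hI.const_mul _) measurable_const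

end Coefficients

/-! ### Functions whose positively weighted sums over finite sets vanish -/

section PositiveSums

variable {S : Type*} [Infinite S]

/-- If every set of `n + 1` points of an infinite set carries positive weights for which the
weighted sum of the real function `f` vanishes, then `f = 0`. -/
theorem eq_zero_of_forall_weighted_sum_eq_zero (n : ℕ) (f : S → ℝ)
    (h : ∀ T : Finset S, T.card = n + 1 →
      ∃ t : S → ℝ, (∀ c ∈ T, 0 < t c) ∧ ∑ c ∈ T, t c * f c = 0) (c : S) : f c = 0 := by
  classical
  -- As soon as `f` has a constant weak sign on an infinite set, it vanishes there.
  have key : ∀ g : S → ℝ, (∀ T : Finset S, T.card = n + 1 →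
      ∃ t : S → ℝ, (∀ c ∈ T, 0 < t c) ∧ ∑ c ∈ T, t c * g c = 0) →
      {c | 0 ≤ g c}.Infinite → ∀ c, g c = 0 := by
    intro g hg hinf
    have hsplit : ∀ {A : Set S}, A.Infinite → ∀ c, ∃ T : Finset S, c ∉ T ∧ ↑T ⊆ A ∧ T.card = n := by
      intro A hA c
      obtain ⟨T, hTA, hT⟩ := (hA.sdiff (Set.finite_singleton c)).exists_subset_card_eq n
      exact ⟨T, fun hc => (hTA hc).2 rfl, fun x hx => (hTA hx).1, hT⟩
    have hzero : {c | 0 ≤ g c} ⊆ {c | g c = 0} := by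
      intro c hc
      obtain ⟨T, hcT, hTA, hT⟩ := hsplit hinf c
      obtain ⟨t, ht, hsum⟩ := hg (insert c T) (by rw [Finset.card_insert_of_notMem hcT, hT])
      have hnn : ∀ d ∈ insert c T, 0 ≤ t d * g d := fun d hd => by
        refine mul_nonneg (ht d hd).le ?_
        rcases Finset.mem_insert.1 hd with rfl | hd'
        · exact hc
        · exact hTA hd'
      have h0 := (Finset.sum_eq_zero_iff_of_nonneg hnn).1 hsum c (Finset.mem_insert_self _ _)
      exact (mul_eq_zero.1 h0).resolve_left (ht c (Finset.mem_insert_self _ _)).ne'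
    intro c
    obtain ⟨T, hcT, hTA, hT⟩ := hsplit (hinf.mono hzero) c
    obtain ⟨t, ht, hsum⟩ := hg (insert c T) (by rw [Finset.card_insert_of_notMem hcT, hT])
    have hT0 : ∑ d ∈ T, t d * g d = 0 := Finset.sum_eq_zero fun d hd => by
      have hd0 : g d = 0 := hTA hd
      rw [hd0, mul_zero]
    rw [Finset.sum_insert hcT, hT0, add_zero] at hsum
    exact (mul_eq_zero.1 hsum).resolve_left (ht c (Finset.mem_insert_self _ _)).ne'
  have hunion : ({c | 0 ≤ f c} ∪ {c | 0 ≤ -f c}).Infinite := by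
    have : {c | 0 ≤ f c} ∪ {c | 0 ≤ -f c} = Set.univ := by
      ext c
      simpa using le_total 0 (f c)
    rw [this]
    exact Set.infinite_univ
  rcases Set.infinite_union.1 hunion with hpos | hneg
  · exact key f h hpos c
  · have := key (fun c => -f c) (fun T hT => by
      obtain ⟨t, ht, hsum⟩ := h T hT
      refine ⟨t, ht, ?_⟩
      simp only [mul_neg, Finset.sum_neg_distrib, hsum, neg_zero]) hneg c
    simpa using this

/-- The complex version of `eq_zero_of_forall_weighted_sum_eq_zero`, with real weights. -/
theorem eq_zero_of_forall_weighted_sum_eq_zero_complex (n : ℕ) (f : S → ℂ)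
    (h : ∀ T : Finset S, T.card = n + 1 →
      ∃ t : S → ℝ, (∀ c ∈ T, 0 < t c) ∧ ∑ c ∈ T, (t c : ℂ) * f c = 0) (c : S) : f c = 0 := by
  apply Complex.ext
  · refine eq_zero_of_forall_weighted_sum_eq_zero n (fun c => (f c).re) (fun T hT => ?_) c
    obtain ⟨t, ht, hsum⟩ := h T hT
    refine ⟨t, ht, ?_⟩
    simpa using congrArg Complex.re hsum
  · refine eq_zero_of_forall_weighted_sum_eq_zero n (fun c => (f c).im) (fun T hT => ?_) c
    obtain ⟨t, ht, hsum⟩ := h T hT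
    refine ⟨t, ht, ?_⟩
    simpa using congrArg Complex.im hsum

end PositiveSums

/-! ### Recovering the subgroup from a point of the Bernoulli space -/

section Periods

variable {G : Type*} [Group G]

theorem infinite_rightCosets {Γ : Subgroup G} (hΓ : ¬ Γ.FiniteIndex) : Infinite (RightCosets Γ) := by
  by_contra hcon
  rw [not_infinite_iff_finite] at hcon
  have : Finite (G ⧸ Γ) :=
    Finite.of_equiv _ (QuotientGroup.quotientRightRelEquivQuotientLeftRel Γ)
  exact hΓ Subgroup.finiteIndex_of_finite_quotient

theorem measurable_subgroup_iff [Countable G] {β : Type*} [MeasurableSpace β]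
    {f : β → Subgroup G} : Measurable f ↔ ∀ g, MeasurableSet {b | g ∈ f b} := by
  refine ⟨fun hf g => hf (measurableSet_mem g), fun hf => ?_⟩
  have hcount : {U : Set (Subgroup G) | ∃ T F : Set G, T.Finite ∧ F ⊆ T ∧
      U = {H : Subgroup G | (H : Set G) ∩ T = F}}.Countable := by
    have : {U : Set (Subgroup G) | ∃ T F : Set G, T.Finite ∧ F ⊆ T ∧
        U = {H : Subgroup G | (H : Set G) ∩ T = F}} ⊆
        Set.range fun p : Finset G × Finset G =>
          {H : Subgroup G | (H : Set G) ∩ (p.1 : Set G) = p.2} := by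
      rintro U ⟨T, F, hT, hF, rfl⟩
      refine ⟨(hT.toFinset, (hT.subset hF).toFinset), ?_⟩
      simp only [Set.Finite.coe_toFinset]
    exact (Set.countable_range _).mono this
  have : SecondCountableTopology (Subgroup G) := ⟨_, hcount, rfl⟩
  have hbor := borel_eq_generateFrom_of_subbasis (α := Subgroup G) rfl
  refine Measurable.mono (measurable_generateFrom ?_) le_rfl hbor.le
  rintro U ⟨T, F, hT, hF, rfl⟩
  have : f ⁻¹' {H : Subgroup G | (H : Set G) ∩ T = F} =
      (⋂ g ∈ F, {b | g ∈ f b}) ∩ ⋂ g ∈ T \ F, {b | g ∈ f b}ᶜ := by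
    ext b
    simp only [Set.mem_preimage, Set.mem_ofPred_eq, Set.mem_inter_iff, Set.mem_iInter,
      Set.mem_compl_iff, Set.mem_sdiff]
    constructor
    · rintro rfl
      exact ⟨fun g hg => hg.1, fun g hg hgf => hg.2 ⟨hgf, hg.1⟩⟩
    · rintro ⟨h1, h2⟩
      refine Set.Subset.antisymm (fun g hg => ?_) fun g hg => ⟨h1 g hg, hF hg⟩
      by_contra hgF
      exact h2 g ⟨hg.2, hgF⟩ hg.1
  rw [this]
  exact (MeasurableSet.biInter (Set.to_countable _) fun g _ => hf g).inter
    (MeasurableSet.biInter (Set.to_countable _) fun g _ => (hf g).compl)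

/-- The left periods of `ξ ∘ x`. -/
def periods {K : Type*} (ξ : K → ℝ) (x : ShiftSpace G K) : Subgroup G where
  carrier := {g | ∀ t, ξ (x (g * t)) = ξ (x t)}
  one_mem' t := by rw [one_mul]
  mul_mem' {g h} hg hh t := by rw [mul_assoc, hg, hh]
  inv_mem' {g} hg t := by rw [← hg (g⁻¹ * t), mul_inv_cancel_left]

theorem mem_periods {K : Type*} {ξ : K → ℝ} {x : ShiftSpace G K} {g : G} :
    g ∈ periods ξ x ↔ ∀ t, ξ (x (g * t)) = ξ (x t) := Iff.rfl

variable {K : Type*} [MeasurableSpace K] {ξ : K → ℝ} {κ : Measure K}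

theorem measurable_periods [Countable G] (hξ : Measurable ξ) :
    Measurable (periods ξ : ShiftSpace G K → Subgroup G) := by
  refine measurable_subgroup_iff.2 fun g => ?_
  have : {x : ShiftSpace G K | g ∈ periods ξ x} = ⋂ t, {x | ξ (x (g * t)) = ξ (x t)} := by
    ext x
    simp [mem_periods]
  rw [this]
  exact MeasurableSet.iInter fun t => measurableSet_eq_fun
    (hξ.comp (measurable_pi_apply (X := fun _ : G => K) (g * t)))
    (hξ.comp (measurable_pi_apply (X := fun _ : G => K) t))

/-- An element outside a subgroup `Γ` of infinite index is almost surely not a period.  On the set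
`B` of points with this period the Walsh functions of the infinitely many sets `{Γ t, Γ g t}` are
bounded below, and so are their scalar products with the indicator function of `B` unless `B` is
a null set, which would contradict Bessel's inequality. -/
theorem ae_notMem_periods [Countable G] [IsProbabilityMeasure κ] (hξ : IsStandardized ξ κ)
    {Γ : Subgroup G} (hΓ : ¬ Γ.FiniteIndex) {g : G} (hg : g ∉ Γ) :
    ∀ᵐ w ∂(Measure.infinitePi fun _ : RightCosets Γ => κ), g ∉ periods ξ (ofCosets Γ w) := by
  classical
  set m := Measure.infinitePi fun _ : RightCosets Γ => κ with hm
  set B : Set (RightCosets Γ → K) := {w | g ∈ periods ξ (ofCosets Γ w)} with hB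
  have hBm : MeasurableSet B :=
    ((measurable_periods hξ.measurable).comp (measurable_ofCosets Γ)) (measurableSet_mem g)
  have hne : ∀ t : G, rightCoset Γ t ≠ rightCoset Γ (g * t) := fun t h => by
    rw [rightCoset_eq_iff] at h
    exact hg (by simpa using h)
  set T : G → Finset (RightCosets Γ) := fun t => {rightCoset Γ t, rightCoset Γ (g * t)} with hT
  have hTinf : (Set.range T).Infinite := by
    intro hfin
    have hinf := infinite_rightCosets hΓ
    have hcov : (⋃ U ∈ Set.range T, (U : Set (RightCosets Γ))) = Set.univ := by
      refine Set.eq_univ_of_forall fun c => ?_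
      obtain ⟨t, rfl⟩ := Quotient.exists_rep c
      refine Set.mem_biUnion (Set.mem_range_self t) ?_
      exact Finset.mem_coe.2 (Finset.mem_insert_self _ _)
    exact Set.infinite_univ (hcov ▸ hfin.biUnion fun U _ => U.finite_toSet)
  obtain ⟨δ, hδ, hδξ⟩ := hξ.sq_bounded_below
  set f : (RightCosets Γ → K) → ℂ := B.indicator fun _ => 1 with hf
  have hfL : MemLp f 2 m := (memLp_const (1 : ℂ)).indicator hBm
  have hcoef : ∀ t, ENNReal.ofReal (δ * m.real B) ≤ ‖∫ w, f w * walsh ξ (T t) w ∂m‖ₑ := fun t => by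
    have hmeas : Measurable fun w : RightCosets Γ → K => ξ (w (rightCoset Γ t)) :=
      hξ.measurable.comp (measurable_pi_apply _)
    have h1 : ∀ w, f w * walsh ξ (T t) w =
        ((B.indicator (fun w => ξ (w (rightCoset Γ t)) * ξ (w (rightCoset Γ t))) w : ℝ) : ℂ) := by
      intro w
      by_cases hw : w ∈ B
      · have hper : ξ (w (rightCoset Γ (g * t))) = ξ (w (rightCoset Γ t)) := hw t
        rw [hf, Set.indicator_of_mem hw, Set.indicator_of_mem hw, one_mul, walsh, hT,
          Finset.prod_pair (hne t), hper, Complex.ofReal_mul]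
      · rw [hf, Set.indicator_of_notMem hw, Set.indicator_of_notMem hw, zero_mul,
          Complex.ofReal_zero]
    obtain ⟨M, hM⟩ := hξ.bounded
    have hint : IntegrableOn (fun w => ξ (w (rightCoset Γ t)) * ξ (w (rightCoset Γ t))) B m := by
      refine (Integrable.of_bound (hmeas.mul hmeas).aestronglyMeasurable (M * M)
        (ae_of_all _ fun w => ?_)).integrableOn
      refine (norm_mul _ _).trans_le ?_
      exact mul_self_le_mul_self (norm_nonneg _) (hM _)
    have hlow : δ * m.real B ≤
        ∫ w in B, ξ (w (rightCoset Γ t)) * ξ (w (rightCoset Γ t)) ∂m := by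
      rw [mul_comm]
      have := setIntegral_mono_on (μ := m) (f := fun _ => δ) (integrable_const δ).integrableOn hint
        hBm fun w _ => hδξ _
      rwa [setIntegral_const, smul_eq_mul] at this
    simp only [h1]
    rw [integral_complex_ofReal, integral_indicator hBm, ← ofReal_norm, Complex.norm_real]
    exact ENNReal.ofReal_le_ofReal (hlow.trans (le_abs_self _))
  have hBessel := hξ.tsum_sq_integral_mul_walsh_le hfL
  have hfin : ∫⁻ w, ‖f w‖ₑ ^ 2 ∂m < ∞ := by
    refine lt_of_le_of_lt (lintegral_mono (g := fun _ => 1) fun w => ?_) (by simp)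
    by_cases hw : w ∈ B
    · simp [hf, hw]
    · simp [hf, hw]
  by_contra hcon
  have hB0 : m B ≠ 0 := fun h0 => hcon (measure_eq_zero_iff_ae_notMem.1 h0)
  have hpos : 0 < δ * m.real B := mul_pos hδ (ENNReal.toReal_pos hB0 (measure_ne_top m B))
  have : Infinite (Set.range T) := hTinf.to_subtype
  have htop : ∑' U : Set.range T, ‖∫ w, f w * walsh ξ U.1 w ∂m‖ₑ ^ 2 = ∞ := by
    rw [← top_le_iff]
    refine le_trans (ENNReal.tsum_const_eq_top_of_ne_zero (α := Set.range T)
      (c := ENNReal.ofReal (δ * m.real B) ^ 2) ?_).ge (ENNReal.tsum_le_tsum fun U => ?_)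
    · exact pow_ne_zero 2 (ENNReal.ofReal_pos.2 hpos).ne'
    · obtain ⟨U, t, rfl⟩ := U
      gcongr
      exact hcoef t
  refine (lt_of_le_of_lt ?_ hfin).ne htop
  exact (ENNReal.tsum_comp_le_tsum_of_injective Subtype.val_injective
    fun U : Finset (RightCosets Γ) => ‖∫ w, f w * walsh ξ U w ∂m‖ₑ ^ 2).trans hBessel

/-- For a subgroup `Γ` of infinite index, almost every point of `(K^G, κ^{Γ\G})` has exactly `Γ` as
its group of periods. -/
theorem ae_periods_eq [Countable G] [IsProbabilityMeasure κ] (hξ : IsStandardized ξ κ)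
    {Γ : Subgroup G} (hΓ : ¬ Γ.FiniteIndex) : ∀ᵐ x ∂(bernoulli κ Γ), periods ξ x = Γ := by
  have hset : {x : ShiftSpace G K | periods ξ x = Γ} =
      ⋂ g, {x | g ∈ periods ξ x ↔ g ∈ Γ} := by
    ext x
    simp only [Set.mem_ofPred_eq, Set.mem_iInter]
    exact SetLike.ext_iff
  have hmeas : MeasurableSet {x : ShiftSpace G K | periods ξ x = Γ} := by
    rw [hset]
    refine MeasurableSet.iInter fun g => ?_
    exact (measurable_periods hξ.measurable (measurableSet_mem g)).iff (MeasurableSet.const _)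
  rw [bernoulli, ae_map_iff (measurable_ofCosets Γ).aemeasurable hmeas]
  have hall : ∀ᵐ w ∂(Measure.infinitePi fun _ : RightCosets Γ => κ), ∀ g, g ∉ Γ →
      g ∉ periods ξ (ofCosets Γ w) := by
    refine ae_all_iff.2 fun g => ?_
    by_cases hg : g ∈ Γ
    · exact ae_of_all _ fun w h => absurd hg h
    · filter_upwards [ae_notMem_periods hξ hΓ hg] with w hw _ using hw
  filter_upwards [hall] with w hw
  ext g
  refine ⟨fun hg => not_not.1 fun hg' => hw g hg' hg, fun hg t => ?_⟩
  have : rightCoset Γ (g * t) = rightCoset Γ t := by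
    rw [rightCoset_eq_iff]
    simpa using inv_mem hg
  change ξ (w (rightCoset Γ (g * t))) = ξ (w (rightCoset Γ t))
  rw [this]

end Periods

/-! ### Integration over the coset bundle and over the Bernoulli extension -/

section Bundle

variable {G : Type*} [Group G] [Countable G] {Z : Type*} [MeasurableSpace Z] [MulAction G Z]
  {Γ : Z →[G] Subgroup G}

theorem CosetBundle.ae_of_ae_base (hΓ : Measurable Γ) {ω : Measure Z} {p : Z → Prop}
    (h : ∀ᵐ z ∂ω, p z) : ∀ᵐ e ∂(CosetBundle.measure Γ ω), p e.base :=
  (CosetBundle.quasiMeasurePreserving_base hΓ ω).ae h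

/-- An integrable function on the bundle whose integrals over the preimages of all sets in the base
vanish has vanishing sums over almost all fibres. -/
theorem CosetBundle.ae_tsum_eq_zero (hΓ : Measurable Γ) {ω : Measure Z}
    {k : CosetBundle Γ → ℂ} (hkm : Measurable k) (hk : Integrable k (CosetBundle.measure Γ ω))
    (h : ∀ B : Set Z, MeasurableSet B →
      ∫ e in CosetBundle.base ⁻¹' B, k e ∂(CosetBundle.measure Γ ω) = 0) :
    ∀ᵐ z ∂ω, ∑' c : RightCosets (Γ z), k ⟨z, c⟩ = 0 := by
  let η : ProbabilityTheory.Kernel Z (CosetBundle Γ) :=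
    ⟨fun z => Measure.sum fun c : RightCosets (Γ z) => Measure.dirac (⟨z, c⟩ : CosetBundle Γ),
      CosetBundle.measurable_fibreMeasure hΓ⟩
  have hcomp : CosetBundle.measure Γ ω =
      (ProbabilityTheory.Kernel.comp η (ProbabilityTheory.Kernel.const Unit ω)) () := by
    rw [ProbabilityTheory.Kernel.comp_apply]
    rfl
  rw [hcomp] at hk
  have hfib : ∀ k' : CosetBundle Γ → ℂ, Measurable k' → ∀ z, Integrable k' (η z) →
      ∫ e, k' e ∂(η z) = ∑' c : RightCosets (Γ z), k' ⟨z, c⟩ := fun k' hk' z hz => by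
    change ∫ e, k' e ∂(Measure.sum fun c : RightCosets (Γ z) =>
      Measure.dirac (⟨z, c⟩ : CosetBundle Γ)) = _
    rw [integral_sum_measure hz]
    exact tsum_congr fun c => integral_dirac' _ _ hk'.stronglyMeasurable
  have hzero : (fun z => ∫ e, k e ∂(η z)) =ᵐ[ω] 0 := by
    refine Integrable.ae_eq_zero_of_forall_setIntegral_eq_zero hk.integral_comp fun B hB _ => ?_
    have hB' := CosetBundle.measurable_base (Γ := Γ) hB
    have h1 := ProbabilityTheory.Kernel.integral_comp (hk.indicator hB')
    rw [← hcomp, integral_indicator hB', h B hB, ProbabilityTheory.Kernel.const_apply] at h1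
    rw [← integral_indicator hB, h1]
    refine integral_congr_ae ?_
    filter_upwards [hk.ae_of_comp] with z hz
    rw [hfib _ (hkm.indicator hB') z (hz.indicator hB')]
    by_cases hzB : z ∈ B
    · rw [Set.indicator_of_mem hzB, hfib k hkm z hz]
      exact tsum_congr fun c => (Set.indicator_of_mem (s := CosetBundle.base ⁻¹' B)
        (a := (⟨z, c⟩ : CosetBundle Γ)) hzB k).symm
    · rw [Set.indicator_of_notMem hzB]
      exact ((tsum_congr fun c => Set.indicator_of_notMem (s := CosetBundle.base ⁻¹' B)
        (a := (⟨z, c⟩ : CosetBundle Γ)) hzB k).trans tsum_zero).symm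
  filter_upwards [hzero, hk.ae_of_comp] with z h1 h2
  rw [← hfib k hkm z h2, h1, Pi.zero_apply]

end Bundle

section Extension

variable {G K : Type*} [Group G] [Countable G] [MeasurableSpace K] {κ : Measure K}
  [IsProbabilityMeasure κ] {Y Z : Type*} [MeasurableSpace Y] [MeasurableSpace Z]
  {Γ : Z → Subgroup G} {π : Z → Y} {ω : Measure Z}

theorem ae_ae_of_ae_extensionMeasure (hΓ : Measurable Γ) (hπ : Measurable π)
    {p : ShiftSpace G K × Y → Prop} (h : ∀ᵐ x ∂(extensionMeasure κ Γ π ω), p x) :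
    ∀ᵐ z ∂ω, ∀ᵐ x ∂(bernoulli κ (Γ z)), p (x, π z) := by
  let η : ProbabilityTheory.Kernel Z (ShiftSpace G K × Y) :=
    ⟨_, measurable_bernoulli_prod_dirac κ hΓ hπ⟩
  have h' : ∀ᵐ z ∂ω, ∀ᵐ x ∂(η z), p x := Measure.ae_ae_of_ae_comp h
  filter_upwards [h'] with z hz
  change ∀ᵐ x ∂((bernoulli κ (Γ z)).prod (Measure.dirac (π z))), p x at hz
  rw [Measure.prod_dirac] at hz
  exact ae_of_ae_map measurable_prodMk_right.aemeasurable hz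

theorem lintegral_extensionMeasure (hΓ : Measurable Γ) (hπ : Measurable π)
    {f : ShiftSpace G K × Y → ℝ≥0∞} (hf : Measurable f) :
    ∫⁻ x, f x ∂(extensionMeasure κ Γ π ω) = ∫⁻ z, ∫⁻ x, f (x, π z) ∂(bernoulli κ (Γ z)) ∂ω := by
  rw [extensionMeasure, Measure.lintegral_bind
    (measurable_bernoulli_prod_dirac κ hΓ hπ).aemeasurable hf.aemeasurable]
  refine lintegral_congr fun z => ?_
  rw [Measure.prod_dirac, lintegral_map hf measurable_prodMk_right]

theorem ae_memLp_extensionMeasure (hΓ : Measurable Γ) (hπ : Measurable π)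
    {F : ShiftSpace G K × Y → ℂ} (hFm : Measurable F) (hF : MemLp F 2 (extensionMeasure κ Γ π ω)) :
    ∀ᵐ z ∂ω, MemLp (fun x => F (x, π z)) 2 (bernoulli κ (Γ z)) := by
  have hfin : ∫⁻ x, ‖F x‖ₑ ^ 2 ∂(extensionMeasure κ Γ π ω) < ∞ := by
    rw [lintegral_enorm_sq_eq]
    exact ENNReal.pow_lt_top hF.2
  have hm : Measurable fun x => ‖F x‖ₑ ^ 2 := hFm.enorm.pow_const 2
  rw [lintegral_extensionMeasure hΓ hπ hm] at hfin
  have hmeas : AEMeasurable (fun z => ∫⁻ x, ‖F (x, π z)‖ₑ ^ 2 ∂(bernoulli κ (Γ z))) ω := by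
    have h1 := (Measure.measurable_lintegral hm).comp (measurable_bernoulli_prod_dirac κ hΓ hπ)
    refine (h1.aemeasurable (μ := ω)).congr (ae_of_all _ fun z => ?_)
    simp only [Function.comp_apply]
    rw [Measure.prod_dirac, lintegral_map hm measurable_prodMk_right]
  filter_upwards [ae_lt_top' hmeas hfin.ne] with z hz
  refine ⟨(hFm.comp measurable_prodMk_right).aestronglyMeasurable, ?_⟩
  rw [lintegral_enorm_sq_eq] at hz
  exact (ENNReal.pow_lt_top_iff.1 hz).resolve_right two_ne_zero

end Extension

/-! ### The intertwining operators -/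

section PatternOperator

variable {G K : Type*} [Group G] [MeasurableSpace K] {Y Z : Type*} [MulAction G Z]
  {Γ : Z →[G] Subgroup G}

/-- The function `(z, c) ↦ ⟨F(·, π z), v_n(c)⟩` on the coset bundle attached to a function `F` on
`K^G × Y`. -/
def patternFun (ξ : K → ℝ) (κ : Measure K) (u : Finset G → NNReal) (n : ℕ) (π : Z → Y)
    (F : ShiftSpace G K × Y → ℂ) (e : CosetBundle Γ) : ℂ :=
  patternCoeff ξ κ u n (fun x => F (x, π e.base)) e.coset

variable [Countable G] [MeasurableSpace Y] [MeasurableSpace Z] {ξ : K → ℝ} {κ : Measure K}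
  [IsProbabilityMeasure κ] {u : Finset G → NNReal} {π : Z → Y} {ω : Measure Z}

theorem measurable_patternFun (hξ : IsStandardized ξ κ) (n : ℕ) (hΓ : Measurable Γ)
    (hπ : Measurable π) {F : ShiftSpace G K × Y → ℂ} (hF : Measurable F) :
    Measurable (patternFun (Γ := Γ) ξ κ u n π F) :=
  CosetBundle.measurable_iff.2 fun h => measurable_patternCoeff hξ n hΓ hπ hF h

theorem patternFun_congr (n : ℕ) (hΓ : Measurable Γ) (hπ : Measurable π)
    {F F' : ShiftSpace G K × Y → ℂ} (h : F =ᵐ[extensionMeasure κ Γ π ω] F') :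
    patternFun (Γ := Γ) ξ κ u n π F =ᵐ[CosetBundle.measure Γ ω] patternFun ξ κ u n π F' := by
  filter_upwards [CosetBundle.ae_of_ae_base hΓ (ae_ae_of_ae_extensionMeasure hΓ hπ h)] with e he
  exact patternCoeff_congr n he e.coset

theorem lintegral_sq_patternFun_le (hξ : IsStandardized ξ κ) (hu : ∑' P, (u P : ℝ≥0∞) ≤ 1)
    (n : ℕ) (hΓ : Measurable Γ) (hπ : Measurable π) {F : ShiftSpace G K × Y → ℂ}
    (hFm : Measurable F) (hF : MemLp F 2 (extensionMeasure κ Γ π ω)) :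
    ∫⁻ e, ‖patternFun (Γ := Γ) ξ κ u n π F e‖ₑ ^ 2 ∂(CosetBundle.measure Γ ω) ≤
      2 * (n + 1) * ∫⁻ x, ‖F x‖ₑ ^ 2 ∂(extensionMeasure κ Γ π ω) := by
  have hm : Measurable fun e => ‖patternFun (Γ := Γ) ξ κ u n π F e‖ₑ ^ 2 :=
    (measurable_patternFun hξ n hΓ hπ hFm).enorm.pow_const 2
  have hm' : Measurable fun x => ‖F x‖ₑ ^ 2 := hFm.enorm.pow_const 2
  have hC : (2 * (n + 1) : ℝ≥0∞) ≠ ∞ :=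
    ENNReal.mul_ne_top ENNReal.ofNat_ne_top (by finiteness)
  have hle : ∀ᵐ z ∂ω, ∑' c : RightCosets (Γ z), ‖patternFun ξ κ u n π F ⟨z, c⟩‖ₑ ^ 2 ≤
      2 * (n + 1) * ∫⁻ x, ‖F (x, π z)‖ₑ ^ 2 ∂(bernoulli κ (Γ z)) := by
    filter_upwards [ae_memLp_extensionMeasure hΓ hπ hFm hF] with z hz
    have h := tsum_sq_patternCoeff_le (u := u) hξ hu n hz
    exact h
  refine (CosetBundle.lintegral_measure hΓ ω hm).trans_le ((lintegral_mono_ae hle).trans_eq ?_)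
  rw [lintegral_const_mul' _ _ hC, lintegral_extensionMeasure hΓ hπ hm']

theorem eLpNorm_patternFun_le (hξ : IsStandardized ξ κ) (hu : ∑' P, (u P : ℝ≥0∞) ≤ 1) (n : ℕ)
    (hΓ : Measurable Γ) (hπ : Measurable π) {F : ShiftSpace G K × Y → ℂ} (hFm : Measurable F)
    (hF : MemLp F 2 (extensionMeasure κ Γ π ω)) :
    eLpNorm (patternFun (Γ := Γ) ξ κ u n π F) 2 (CosetBundle.measure Γ ω) ≤
      2 * (n + 1) * eLpNorm F 2 (extensionMeasure κ Γ π ω) := by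
  have h1 : (1 : ℝ≥0∞) ≤ 2 * (n + 1) := by
    calc (1 : ℝ≥0∞) ≤ 2 * (0 + 1) := by norm_num
      _ ≤ 2 * (n + 1) := by gcongr; exact zero_le
  have h2 := lintegral_sq_patternFun_le hξ hu n hΓ hπ hFm hF
  rw [lintegral_enorm_sq_eq, lintegral_enorm_sq_eq] at h2
  refine (ENNReal.pow_le_pow_left_iff two_ne_zero).1 (h2.trans ?_)
  rw [mul_pow]
  gcongr
  exact le_self_pow₀ h1 two_ne_zero

theorem memLp_patternFun (hξ : IsStandardized ξ κ) (hu : ∑' P, (u P : ℝ≥0∞) ≤ 1) (n : ℕ)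
    (hΓ : Measurable Γ) (hπ : Measurable π) (F : Lp ℂ 2 (extensionMeasure κ Γ π ω)) :
    MemLp (patternFun (Γ := Γ) ξ κ u n π F) 2 (CosetBundle.measure Γ ω) :=
  have hFm : Measurable F := (Lp.stronglyMeasurable F).measurable
  ⟨(measurable_patternFun hξ n hΓ hπ hFm).aestronglyMeasurable,
    (eLpNorm_patternFun_le hξ hu n hΓ hπ hFm (Lp.memLp F)).trans_lt
      (ENNReal.mul_lt_top (by finiteness) (Lp.eLpNorm_lt_top F))⟩

/-- `F ↦ patternFun F` as a bounded operator from `L²` of the Bernoulli extension to the direct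
integral. -/
theorem exists_patternOp (hξ : IsStandardized ξ κ) (hu : ∑' P, (u P : ℝ≥0∞) ≤ 1) (n : ℕ)
    (hΓ : Measurable Γ) (hπ : Measurable π) :
    ∃ S : Lp ℂ 2 (extensionMeasure κ Γ π ω) →L[ℂ] DirectIntegral Γ ω,
      ∀ F, S F =ᵐ[CosetBundle.measure Γ ω] patternFun ξ κ u n π F := by
  let S₀ : Lp ℂ 2 (extensionMeasure κ Γ π ω) →ₗ[ℂ] DirectIntegral Γ ω :=
    { toFun := fun F => (memLp_patternFun hξ hu n hΓ hπ F).toLp (patternFun ξ κ u n π F)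
      map_add' := fun F F' => by
        rw [← MemLp.toLp_add]
        apply MemLp.toLp_congr
        have hm : ∀ F : Lp ℂ 2 (extensionMeasure κ Γ π ω), ∀ᵐ z ∂ω,
            MemLp (fun x => F (x, π z)) 2 (bernoulli κ (Γ z)) := fun F =>
          ae_memLp_extensionMeasure hΓ hπ (Lp.stronglyMeasurable F).measurable (Lp.memLp F)
        filter_upwards [patternFun_congr (ξ := ξ) (u := u) n hΓ hπ (Lp.coeFn_add F F'),
          CosetBundle.ae_of_ae_base hΓ (hm F), CosetBundle.ae_of_ae_base hΓ (hm F')] with e h1 h2 h3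
        rw [h1]
        exact patternCoeff_add hξ hu n h2 h3 e.coset
      map_smul' := fun r F => by
        rw [RingHom.id_apply, ← MemLp.toLp_const_smul]
        apply MemLp.toLp_congr
        filter_upwards [patternFun_congr (ξ := ξ) (u := u) n hΓ hπ (Lp.coeFn_smul r F)] with e h1
        rw [h1]
        exact patternCoeff_const_mul n r _ e.coset }
  refine ⟨S₀.mkContinuous (2 * (n + 1)) fun F => ?_, fun F =>
    (memLp_patternFun hξ hu n hΓ hπ F).coeFn_toLp⟩
  have h := ENNReal.toReal_mono (ENNReal.mul_ne_top (by finiteness) (Lp.eLpNorm_ne_top F))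
    (eLpNorm_patternFun_le hξ hu n hΓ hπ (Lp.stronglyMeasurable F).measurable (Lp.memLp F))
  have hc : (2 * ((n : ℝ≥0∞) + 1)).toReal = 2 * (n + 1) := by
    have := ENNReal.toReal_natCast (2 * (n + 1))
    push_cast at this
    exact this
  rw [ENNReal.toReal_mul, hc] at h
  rw [Lp.norm_def F]
  exact (Lp.norm_toLp _ (memLp_patternFun hξ hu n hΓ hπ F)).trans_le h

end PatternOperator

section TestFunctions

variable {G K : Type*} [Group G] {Y Z : Type*}

/-- The function on `K^G × Y` equal to the Walsh function of the cosets of the elements of `Q`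
where the point `Θ (x, y)` of `Z` lies in `B`; it is `0` elsewhere, and where two elements of `Q`
lie in the same coset. -/
def testFun (ξ : K → ℝ) (Γ : Z → Subgroup G) (Θ : ShiftSpace G K × Y → Z) (B : Set Z)
    (Q : Finset G) : ShiftSpace G K × Y → ℂ :=
  (Θ ⁻¹' (B ∩ {z | (pattern (rightCoset (Γ z) 1) Q).card = Q.card})).indicator
    fun p => ∏ q ∈ Q, (ξ (p.1 (1 * q)) : ℂ)

variable [MeasurableSpace K] {ξ : K → ℝ} {κ : Measure K}

theorem measurable_testFun [MeasurableSpace Y] [MeasurableSpace Z] {Γ : Z → Subgroup G} (hξ : IsStandardized ξ κ) (hΓ : Measurable Γ)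
    {Θ : ShiftSpace G K × Y → Z} (hΘ : Measurable Θ) {B : Set Z} (hB : MeasurableSet B)
    (Q : Finset G) : Measurable (testFun ξ Γ Θ B Q) := by
  refine Measurable.indicator ?_ (hΘ (hB.inter (hΓ (measurableSet_card_pattern 1 Q))))
  exact Finset.measurable_fun_prod _ fun q _ => Complex.measurable_ofReal.comp
    (hξ.measurable.comp ((measurable_pi_apply (X := fun _ : G => K) (1 * q)).comp measurable_fst))

theorem memLp_testFun [MeasurableSpace Y] [MeasurableSpace Z] {Γ : Z → Subgroup G} (hξ : IsStandardized ξ κ) (hΓ : Measurable Γ)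
    {Θ : ShiftSpace G K × Y → Z} (hΘ : Measurable Θ) {B : Set Z} (hB : MeasurableSet B)
    (Q : Finset G) (μ : Measure (ShiftSpace G K × Y)) [IsFiniteMeasure μ] :
    MemLp (testFun ξ Γ Θ B Q) 2 μ := by
  obtain ⟨M, hM⟩ := hξ.bounded
  refine MemLp.of_bound (measurable_testFun hξ hΓ hΘ hB Q).aestronglyMeasurable (∏ q ∈ Q, M)
    (ae_of_all _ fun p => (norm_indicator_le_norm_self _ _).trans ?_)
  rw [norm_prod]
  refine Finset.prod_le_prod (fun i _ => norm_nonneg _) fun i _ => ?_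
  rw [Complex.norm_real]
  exact hM _

/-- The scalar products of a test function with the vectors `v_m(c)`. -/
theorem patternFun_testFun [IsProbabilityMeasure κ] [MulAction G Z] {Γ : Z →[G] Subgroup G}
    {u : Finset G → NNReal} {π : Z → Y} (hξ : IsStandardized ξ κ) (hu0 : ∀ P, 0 < u P)
    (hu : ∑' P, (u P : ℝ≥0∞) ≤ 1) {Θ : ShiftSpace G K × Y → Z} {z : Z}
    (hz : ∀ᵐ x ∂(bernoulli κ (Γ z)), Θ (x, π z) = z) (B : Set Z) (Q : Finset G) (m : ℕ) :
    ∃ t : RightCosets (Γ z) → ℝ,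
      (∀ c, patternFun ξ κ u m π (testFun ξ Γ Θ B Q) (⟨z, c⟩ : CosetBundle Γ) = t c) ∧
      (z ∈ B → (pattern (rightCoset (Γ z) 1) Q).card = Q.card → Q.card = m + 1 →
        ∀ c ∈ pattern (rightCoset (Γ z) 1) Q, 0 < t c) ∧
      ∀ c, (z ∉ B ∨ (pattern (rightCoset (Γ z) 1) Q).card ≠ Q.card ∨ Q.card ≠ m + 1 ∨
        c ∉ pattern (rightCoset (Γ z) 1) Q) → t c = 0 := by
  by_cases hzB : z ∈ B ∧ (pattern (rightCoset (Γ z) 1) Q).card = Q.card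
  · have hF : ∀ c : RightCosets (Γ z),
        patternFun ξ κ u m π (testFun ξ Γ Θ B Q) (⟨z, c⟩ : CosetBundle Γ) =
          patternCoeff ξ κ u m (fun x => ∏ q ∈ Q, (ξ (x (1 * q)) : ℂ)) c := fun c => by
      refine patternCoeff_congr m ?_ c
      filter_upwards [hz] with x hx
      exact Set.indicator_of_mem (by rw [Set.mem_preimage, hx]; exact hzB) _
    have ht := exists_patternCoeff_walsh (u := u) hξ hu0 hu m
      (F := fun x : ShiftSpace G K => ∏ q ∈ Q, (ξ (x (1 * q)) : ℂ))
      (pattern (rightCoset (Γ z) 1) Q) (fun w => (walsh_pattern hzB.2 w).symm)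
    choose t ht1 ht2 ht3 using ht
    refine ⟨t, fun c => (hF c).trans (ht1 c), fun _ h1 h2 c hc => ht2 c hc (h1.trans h2),
      fun c hc => ht3 c ?_⟩
    rcases hc with h | h | h | h
    · exact absurd hzB.1 h
    · exact absurd hzB.2 h
    · exact Or.inr (hzB.2 ▸ h)
    · exact Or.inl h
  · refine ⟨fun _ => 0, fun c => ?_, fun h1 h2 => absurd ⟨h1, h2⟩ hzB, fun _ _ => rfl⟩
    rw [Complex.ofReal_zero, ← patternCoeff_const hξ m 0 c (u := u)]
    refine patternCoeff_congr m ?_ c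
    filter_upwards [hz] with x hx
    exact Set.indicator_of_notMem (by rw [Set.mem_preimage, hx]; exact hzB) _

end TestFunctions

/-! ### The embedding -/

section Totality

variable {G K : Type*} [Group G] [Countable G] [MeasurableSpace K]
  {Y Z : Type*} [MeasurableSpace Y] [MeasurableSpace Z] [MulAction G Z]
  {Γ : Z →[G] Subgroup G} {ξ : K → ℝ} {κ : Measure K} [IsProbabilityMeasure κ]
  {u : Finset G → NNReal} {π : Z → Y} {ω : Measure Z}

/-- A vector of the direct integral is zero if it is orthogonal to the images of all test
functions. -/
theorem eq_zero_of_inner_patternFun_eq_zero (hξ : IsStandardized ξ κ) (hu0 : ∀ P, 0 < u P)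
    (hu : ∑' P, (u P : ℝ≥0∞) ≤ 1) (hΓ : Measurable Γ) (hπ : Measurable π)
    (hinf : ∀ᵐ z ∂ω, ¬ (Γ z).FiniteIndex) {Θ : ShiftSpace G K × Y → Z} (hΘm : Measurable Θ)
    (hΘ : ∀ᵐ z ∂ω, ∀ᵐ x ∂(bernoulli κ (Γ z)), Θ (x, π z) = z)
    [IsFiniteMeasure (extensionMeasure κ Γ π ω)] (n : ℕ) (f : DirectIntegral Γ ω)
    (hf : ∀ (B : Set Z), MeasurableSet B → ∀ Q : Finset G, Q.card = n + 1 →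
      ∫ e, patternFun ξ κ u n π (testFun ξ Γ Θ B Q) e * starRingEnd ℂ (f e)
        ∂(CosetBundle.measure Γ ω) = 0) : f = 0 := by
  have hmem : ∀ Q, MemLp (patternFun (Γ := Γ) ξ κ u n π (testFun ξ Γ Θ Set.univ Q)) 2
      (CosetBundle.measure Γ ω) := fun Q => by
    have hm := measurable_testFun hξ hΓ hΘm MeasurableSet.univ Q
    have hL := memLp_testFun hξ hΓ hΘm MeasurableSet.univ Q (extensionMeasure κ Γ π ω)
    exact ⟨(measurable_patternFun hξ n hΓ hπ hm).aestronglyMeasurable,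
      (eLpNorm_patternFun_le hξ hu n hΓ hπ hm hL).trans_lt
        (ENNReal.mul_lt_top (by finiteness) hL.2)⟩
  have hfm : Measurable f := (Lp.stronglyMeasurable f).measurable
  -- For each `Q` the sum over almost every fibre vanishes.
  have hsum : ∀ Q : Finset G, Q.card = n + 1 → ∀ᵐ z ∂ω, ∑' c : RightCosets (Γ z),
      patternFun ξ κ u n π (testFun ξ Γ Θ Set.univ Q) ⟨z, c⟩ * starRingEnd ℂ (f ⟨z, c⟩) = 0 := by
    intro Q hQ
    have hstar : MemLp (fun e => starRingEnd ℂ (f e)) 2 (CosetBundle.measure Γ ω) :=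
      (Lp.memLp f).star
    refine CosetBundle.ae_tsum_eq_zero hΓ (k := fun e =>
      patternFun ξ κ u n π (testFun ξ Γ Θ Set.univ Q) e * starRingEnd ℂ (f e)) ?_
      ((hmem Q).integrable_mul hstar) fun B hB => ?_
    · exact (measurable_patternFun hξ n hΓ hπ (measurable_testFun hξ hΓ hΘm MeasurableSet.univ Q)).mul
        (RCLike.continuous_conj.measurable.comp hfm)
    · rw [← integral_indicator (CosetBundle.measurable_base hB), ← hf B hB Q hQ]
      refine integral_congr_ae ?_
      filter_upwards [CosetBundle.ae_of_ae_base hΓ hΘ] with e he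
      obtain ⟨z, c⟩ := e
      by_cases hzB : z ∈ B
      · rw [Set.indicator_of_mem (s := CosetBundle.base ⁻¹' B) (a := (⟨z, c⟩ : CosetBundle Γ)) hzB]
        congr 1
        refine patternCoeff_congr n ?_ c
        filter_upwards [he] with x hx
        have hx' : Θ (x, π z) = z := hx
        simp only [testFun, Set.indicator, Set.mem_preimage, Set.mem_inter_iff, hx', hzB,
          Set.mem_univ]
      · rw [Set.indicator_of_notMem (s := CosetBundle.base ⁻¹' B)
          (a := (⟨z, c⟩ : CosetBundle Γ)) hzB]
        obtain ⟨t, ht1, -, ht3⟩ := patternFun_testFun hξ hu0 hu he B Q n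
        have h0 := (ht1 c).trans (congrArg _ (ht3 c (Or.inl hzB)))
        change _ = patternFun ξ κ u n π (testFun ξ Γ Θ B Q) (⟨z, c⟩ : CosetBundle Γ) * _
        rw [h0, Complex.ofReal_zero, zero_mul]
  have hall : ∀ᵐ z ∂ω, ∀ Q : Finset G, Q.card = n + 1 → ∑' c : RightCosets (Γ z),
      patternFun ξ κ u n π (testFun ξ Γ Θ Set.univ Q) ⟨z, c⟩ * starRingEnd ℂ (f ⟨z, c⟩) = 0 := by
    refine ae_all_iff.2 fun Q => ?_
    by_cases hQ : Q.card = n + 1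
    · filter_upwards [hsum Q hQ] with z hz _ using hz
    · exact ae_of_all _ fun z h => absurd h hQ
  have hzero : ∀ᵐ z ∂ω, ∀ c : RightCosets (Γ z), f ⟨z, c⟩ = 0 := by
    filter_upwards [hall, hinf, hΘ] with z hz hzi hzΘ c
    classical
    have : Infinite (RightCosets (Γ z)) := infinite_rightCosets hzi
    have hconj : starRingEnd ℂ (f ⟨z, c⟩) = 0 := by
      refine eq_zero_of_forall_weighted_sum_eq_zero_complex n
        (fun c : RightCosets (Γ z) => starRingEnd ℂ (f ⟨z, c⟩)) (fun T hT => ?_) c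
      -- Every finite set of cosets is given by a set of representatives.
      set Q : Finset G := T.image Quotient.out with hQdef
      have hQ : Q.card = n + 1 := by
        rw [hQdef, Finset.card_image_of_injective _ Quotient.out_injective, hT]
      have hpat : pattern (rightCoset (Γ z) 1) Q = T := by
        rw [pattern, hQdef, Finset.image_image]
        have : cosetMul (rightCoset (Γ z) 1) ∘ Quotient.out = id := funext fun d => by
          rw [Function.comp_apply, cosetMul_rightCoset, one_mul]
          exact Quotient.out_eq d
        rw [this, Finset.image_id]
      obtain ⟨t, ht1, ht2, ht3⟩ := patternFun_testFun hξ hu0 hu hzΘ Set.univ Q n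
      rw [hpat] at ht2 ht3
      refine ⟨t, ht2 (Set.mem_univ z) (hT.trans hQ.symm) hQ, ?_⟩
      rw [← hz Q hQ, tsum_eq_sum (s := T) fun d hd => by
        rw [ht1, ht3 d (Or.inr (Or.inr (Or.inr hd))), Complex.ofReal_zero, zero_mul]]
      exact Finset.sum_congr rfl fun d _ => by rw [ht1]
    simpa using hconj
  apply Lp.ext
  filter_upwards [CosetBundle.ae_of_ae_base hΓ hzero,
    Lp.coeFn_zero ℂ 2 (CosetBundle.measure Γ ω)] with e h1 h2
  rw [h2, Pi.zero_apply]
  exact h1 e.coset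

end Totality

section Embedding

variable {G K : Type*} [Group G] [MeasurableSpace K]
  {Y Z : Type*} [MeasurableSpace Y] [MulAction G Y] [MeasurableSpace Z] [MulAction G Z]
  {Γ : Z →[G] Subgroup G} {ξ : K → ℝ} {κ : Measure K} [IsProbabilityMeasure κ]
  {u : Finset G → NNReal} {π : Z → Y} {ω : Measure Z} {ν : Measure Y}

/-- Equivariance of the vectors `v_n(c)` in the form in which it makes `F ↦ patternFun F` an
intertwiner. -/
theorem patternFun_rep_single (h : IsFactorMap G π ω ν) (n : ℕ) (s : Y → ℂ) (g : G)
    (F : ShiftSpace G K × Y → ℂ) (e : CosetBundle Γ) :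
    patternFun ξ κ u n π (fun p => s p.2 * F (g⁻¹ • p)) e =
      s (π e.base) * patternFun ξ κ u n π F (g⁻¹ • e) := by
  refine (patternCoeff_const_mul n (s (π e.base)) (fun x => F (g⁻¹ • (x, π e.base)))
    e.coset).trans ?_
  congr 1
  have h1 : (fun x : ShiftSpace G K => F (g⁻¹ • (x, π e.base))) =
      fun x => (fun x' => F (x', π (g⁻¹ • e.base))) (g⁻¹ • x) := by
    funext x
    rw [h.equivariant]
    rfl
  rw [h1]
  exact patternCoeff_smul g⁻¹ (map_smul Γ g⁻¹ e.base) n (fun x' => F (x', π (g⁻¹ • e.base))) e.coset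

variable [Countable G] [MeasurableConstSMul G Y]

theorem patternOp_eq_zero_of_mem_L2Base (hξ : IsStandardized ξ κ) (h : IsFactorMap G π ω ν)
    (hΓ : Measurable Γ) (n : ℕ)
    {S : Lp ℂ 2 (extensionMeasure κ Γ π ω) →L[ℂ] DirectIntegral Γ ω}
    (hS : ∀ F, S F =ᵐ[CosetBundle.measure Γ ω] patternFun ξ κ u n π F)
    {F : Lp ℂ 2 (extensionMeasure κ Γ π ω)} (hF : F ∈ (h.extension κ hΓ).L2Base) : S F = 0 := by
  obtain ⟨f, rfl⟩ := hF
  apply Lp.ext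
  have hc : ⇑(Lp.compMeasurePreservingₗᵢ ℂ Prod.snd (h.extension κ hΓ).map_preserving f)
      =ᵐ[extensionMeasure κ Γ π ω] fun p => f p.2 := Lp.coeFn_compMeasurePreserving _ _
  filter_upwards [hS _, patternFun_congr (Γ := Γ) (ξ := ξ) (u := u) n hΓ
    h.map_preserving.measurable hc, Lp.coeFn_zero ℂ 2 (CosetBundle.measure Γ ω)] with e e1 e2 e3
  refine e1.trans (e2.trans (Eq.trans ?_ e3.symm))
  exact patternCoeff_const hξ n (f (π e.base)) e.coset

variable [SMulInvariantMeasure G Y ν]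

theorem patternOp_koopmanRep (h : IsFactorMap G π ω ν) (hΓ : Measurable Γ) (n : ℕ)
    {S : Lp ℂ 2 (extensionMeasure κ Γ π ω) →L[ℂ] DirectIntegral Γ ω}
    (hS : ∀ F, S F =ᵐ[CosetBundle.measure Γ ω] patternFun ξ κ u n π F)
    (a : CrossedProduct G ν) (F : Lp ℂ 2 (extensionMeasure κ Γ π ω)) :
    S ((h.extension κ hΓ).koopmanRep a F) = leftRegularRep h hΓ a (S F) := by
  have hπ := h.map_preserving.measurable
  induction a using SkewMonoidAlgebra.induction_on with
  | zero => simp only [map_zero, zero_apply]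
  | add a b ha hb =>
    simp only [map_add, add_apply, ha, hb]
  | single g s =>
    apply Lp.ext
    have h1 := (h.extension κ hΓ).isEquivariantOver.coeFn_rep_single g s F
    have h2 := (h.cosetBundle hΓ).coeFn_rep_single g s (S F)
    filter_upwards [hS ((h.extension κ hΓ).koopmanRep (SkewMonoidAlgebra.single g s) F),
      patternFun_congr (Γ := Γ) (ξ := ξ) (u := u) n hΓ hπ h1, h2,
      (h.cosetBundle hΓ).ae_smul g (hS F)] with e e1 e2 e3 e4
    refine e1.trans (e2.trans (Eq.trans ?_ e3.symm))
    rw [e4]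
    exact patternFun_rep_single h n s g F e

/-- The embedding of `λ^{⊕ℕ}` for a factor map `π : (Z, ω) → (Y, ν)` and an equivariant field of
subgroups on `Z`, under the assumption that almost all points `z` are determined, through `Θ`, by a
typical point of `(K^G, κ^{Γ_z\G})` and `π z`. -/
theorem embeds_of_recoverable [IsProbabilityMeasure ν]
    (hξ : IsStandardized ξ κ)
    (h : IsFactorMap G π ω ν) (hΓ : Measurable Γ) (hinf : ∀ᵐ z ∂ω, ¬ (Γ z).FiniteIndex)
    {Θ : ShiftSpace G K × Y → Z} (hΘm : Measurable Θ)
    (hΘ : ∀ᵐ z ∂ω, ∀ᵐ x ∂(bernoulli κ (Γ z)), Θ (x, π z) = z) :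
    Embeds (countableSumRep (leftRegularRep h hΓ)) (h.extension κ hΓ).koopmanRepCompl := by
  have hπ := h.map_preserving.measurable
  have : IsFiniteMeasure (extensionMeasure κ Γ π ω) := ⟨by
    have := (h.extension κ hΓ).map_preserving.measure_preimage MeasurableSet.univ.nullMeasurableSet
    rw [Set.preimage_univ] at this
    rw [this]
    exact measure_lt_top ν _⟩
  obtain ⟨u, hu0, hu⟩ := ENNReal.exists_pos_sum_of_countable one_ne_zero (Finset G)
  choose S hS using fun n => exists_patternOp (Γ := Γ) (ω := ω) hξ hu.le n hΓ hπ
  have hScongr : ∀ n (F : Lp ℂ 2 (extensionMeasure κ Γ π ω)) {F' : ShiftSpace G K × Y → ℂ},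
      F =ᵐ[extensionMeasure κ Γ π ω] F' →
      S n F =ᵐ[CosetBundle.measure Γ ω] patternFun ξ κ u n π F' := fun n F F' hF =>
    (hS n F).trans (patternFun_congr n hΓ hπ hF)
  refine Embeds.countableSum_of_family _ _ S (fun n a F => patternOp_koopmanRep h hΓ n (hS n) a F)
    (fun n F hF => patternOp_eq_zero_of_mem_L2Base hξ h hΓ n (hS n) hF)
    (fun n => {F | ∃ B : Set Z, MeasurableSet B ∧ ∃ Q : Finset G, Q.card = n + 1 ∧
      F =ᵐ[extensionMeasure κ Γ π ω] testFun ξ Γ Θ B Q}) ?_ fun n f hf => ?_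
  · rintro m n hmn F ⟨B, -, Q, hQ, hF⟩
    apply Lp.ext
    filter_upwards [hScongr m F hF, CosetBundle.ae_of_ae_base hΓ hΘ,
      Lp.coeFn_zero ℂ 2 (CosetBundle.measure Γ ω)] with e h1 h2 h3
    obtain ⟨z, c⟩ := e
    obtain ⟨t, ht1, -, ht3⟩ := patternFun_testFun hξ hu0 hu.le h2 B Q m
    have hne : Q.card ≠ m + 1 := fun h => hmn (by omega)
    rw [h1, h3, Pi.zero_apply]
    exact (ht1 c).trans (by rw [ht3 c (Or.inr (Or.inr (Or.inl hne))), Complex.ofReal_zero])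
  · refine eq_zero_of_inner_patternFun_eq_zero hξ hu0 hu.le hΓ hπ hinf hΘm hΘ n f fun B hB Q hQ => ?_
    have hL := memLp_testFun hξ hΓ hΘm hB Q (extensionMeasure κ Γ π ω)
    have h0 := hf (hL.toLp _) ⟨B, hB, Q, hQ, hL.coeFn_toLp⟩
    rw [L2.inner_def] at h0
    rw [← h0]
    refine integral_congr_ae ?_
    filter_upwards [hScongr n _ hL.coeFn_toLp] with e he
    rw [he, RCLike.inner_apply]

end Embedding

end NonfreeBernoulli

end

theorem lemma3p1
    {G : Type*} [Group G] [Countable G]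
    {Y : Type*} [MeasurableSpace Y] [MulAction G Y] [MeasurableConstSMul G Y]
    (ν : Measure Y) [IsProbabilityMeasure ν] [SMulInvariantMeasure G Y ν]
    {K : Type*} [MeasurableSpace K] (κ : Measure K) [IsProbabilityMeasure κ]
    (hκ : ∃ A : Set K, MeasurableSet A ∧ κ A ≠ 0 ∧ κ A ≠ 1) :
    (∀ (Γ : Y →[G] Subgroup G) (hΓ : Measurable Γ), (∀ y : Y, ¬ (Γ y).FiniteIndex) →
      NonfreeBernoulli.Embeds
        (NonfreeBernoulli.countableSumRep
          (NonfreeBernoulli.leftRegularRep (π := id) (ω := ν) (ν := ν) (Γ := Γ)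
            (NonfreeBernoulli.isFactorMap_id ν) hΓ))
        (NonfreeBernoulli.IsFactorMap.koopmanRepCompl
          (φ := Prod.snd) (μ := NonfreeBernoulli.extensionMeasure κ Γ id ν) (ν := ν)
          ((NonfreeBernoulli.isFactorMap_id ν).extension κ hΓ))) ∧
    (∀ (ω : Measure (Subgroup G × Y)) [IsProbabilityMeasure ω]
      (hω : ∀ g : G, MeasurePreserving (fun p : Subgroup G × Y => g • p) ω ω)
      (hproj : MeasurePreserving Prod.snd ω ν),
      (∀ᵐ p ∂ω, ¬ (p.1 : Subgroup G).FiniteIndex) →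
      NonfreeBernoulli.Embeds
        (NonfreeBernoulli.countableSumRep
          (NonfreeBernoulli.leftRegularRep (π := Prod.snd) (ω := ω) (ν := ν)
            (Γ := MulActionHom.fst G (Subgroup G) Y)
            (NonfreeBernoulli.isFactorMap_snd hω hproj) measurable_fst))
        (NonfreeBernoulli.IsFactorMap.koopmanRepCompl
          (φ := Prod.snd)
          (μ := NonfreeBernoulli.extensionMeasure κ
            (MulActionHom.fst G (Subgroup G) Y) Prod.snd ω) (ν := ν)
          ((NonfreeBernoulli.isFactorMap_snd hω hproj).extension κ
            (Γ := MulActionHom.fst G (Subgroup G) Y) measurable_fst))) := by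
  obtain ⟨ξ, hξ⟩ := NonfreeBernoulli.exists_isStandardized hκ
  refine ⟨fun Γ hΓ hinf => ?_, fun ω _ hω hproj hinf => ?_⟩
  · exact NonfreeBernoulli.embeds_of_recoverable hξ (NonfreeBernoulli.isFactorMap_id ν) hΓ
      (ae_of_all _ hinf) (Θ := Prod.snd) measurable_snd (ae_of_all _ fun y => ae_of_all _ fun x => rfl)
  · refine NonfreeBernoulli.embeds_of_recoverable hξ (NonfreeBernoulli.isFactorMap_snd hω hproj)
      (Γ := MulActionHom.fst G (Subgroup G) Y) measurable_fst hinf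
      (Θ := fun p => (NonfreeBernoulli.periods ξ p.1, p.2))
      (((NonfreeBernoulli.measurable_periods hξ.measurable).comp measurable_fst).prodMk
        measurable_snd) ?_
    filter_upwards [hinf] with p hp
    filter_upwards [NonfreeBernoulli.ae_periods_eq hξ hp] with x hx
    exact Prod.ext hx rfl
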